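/- Let $X$ be a separable real Hilbert space and $\mu=\mathcal N_{0,Q}$ a Gaussian measure on $X$ with mean $0$ and covariance operator $Q$, where $Q$ is self-adjoint, strictly positive and of finite trace; fix an orthonormal basis $(e_k)$ of $X$ with $Qe_k=\lambda_k e_k$. Let $\mathcal{FC}^1_b(X)$ be the set of functions $x\mapsto\phi(\langle x,e_{1}\rangle,\dots,\langle x,e_{n}\rangle)$ with $n\in\mathbb N$ and $\phi\in C^1_b(\mathbb R^n)$. For $\theta\in\mathbb R$ and $1\le p<\infty$, let $W^{1,p}_\theta(X,\mu)\subset L^p(X,\mu)$ be the domain of the closure (still denoted $Q^\theta D$) in $L^p(X,\mu)$ of the operator $Q^\theta D:\mathcal{FC}^1_b(X)\to L^p(X,\mu;X)$, where $D$ is the gradient, with norm $\|u\|_{W^{1,p}_\theta}=\big(\int_X(|u|^p+\|Q^\theta Du\|^p)\,d\mu\big)^{1/p}$. (The subscript in $W^{1,p}_0$ is $\theta=0$; it is not a boundary condition.) Let $U:X\to\mathbb R\cup\{+\infty\}$ be convex, lower semicontinuous and bounded from below. At points with $U(x)<\infty$ its subdifferential is $\partial U(x)=\{z\in X: U(y)\ge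 U(x)+\langle z,y-x\rangle\ \forall y\in X\}$, and $\partial U(x)=\emptyset$ where $U(x)=+\infty$. When $\partial U(x)\neq\emptyset$, let $D_0U(x)$ be its element of minimal norm. For $\alpha>0$ let $$U_\alpha(x)=\inf_{y\in X}\Big\{U(y)+\frac{\|x-y\|^2}{2\alpha}\Big\}.$$ **Lemma 2.2.** Assume that for some $p_1>1$ the function $x\mapsto\|D_0U(x)\|$ belongs to $L^{p_1}(X,\mu)$; in particular, $\partial U(x)\ne\emptyset$ for $\mu$-a.e. $x$. Then for every $p_0$ with $1\le p_0<p_1$: 1. $U$ is finite $\mu$-a.e., $U\in W^{1,p_0}_0(X,\mu)$, and $DU=D_0U$ $\mu$-a.e.; 2. for every $\theta\ge0$, $U\in W^{1,p_0}_\theta(X,\mu)$, $U_\alpha\in W^{1,p_0}_\theta(X,\mu)$ for all $\alpha>0$, and $U_\alpha\to U$ in $W^{1,p_0}_\theta(X,\mu)$ as $\alpha\to0^+$. -/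

import Mathlib

open MeasureTheory ProbabilityTheory Filter Topology
open scoped ENNReal InnerProductSpace

namespace GaussSobolev

section Convex

variable {X : Type*} [NormedAddCommGroup X] [InnerProductSpace ℝ X]

/-- Convexity of an extended-real-valued function `U : X → ℝ ∪ {+∞}`.
(It is only used for functions that never take the value `-∞`.) -/
def IsConvex (U : X → EReal) : Prop :=
  ∀ (x y : X) (a b : ℝ), 0 < a → 0 < b → a + b = 1 →
    U (a • x + b • y) ≤ (a : EReal) * U x + (b : EReal) * U y

/-- The subdifferential of `U` at `x`; it is empty where `U x = +∞`. -/
def subdifferential (U : X → EReal) (x : X) : Set X :=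
  {z | U x ≠ ⊤ ∧ ∀ y, U x + ((⟪z, y - x⟫_ℝ : ℝ) : EReal) ≤ U y}

/-- `z` is an element of minimal norm of the subdifferential of `U` at `x`. -/
def IsMinNormSubgradient (U : X → EReal) (x z : X) : Prop :=
  z ∈ subdifferential U x ∧ ∀ w ∈ subdifferential U x, ‖z‖ ≤ ‖w‖

open Classical in
/-- `D₀U x`, the element of minimal norm of the subdifferential of `U` at `x`. It exists, and is
unique, exactly where the subdifferential is nonempty (see `minNormSubgradient_spec` and
`IsMinNormSubgradient.eq_minNormSubgradient`); the value is `0` elsewhere. -/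
noncomputable def minNormSubgradient (U : X → EReal) (x : X) : X :=
  if h : ∃ z, IsMinNormSubgradient U x z then h.choose else 0

/-- The Moreau–Yosida approximation `U_α(x) = inf_y (U(y) + ‖x - y‖² / (2α))`. -/
noncomputable def moreauYosida (U : X → EReal) (α : ℝ) (x : X) : EReal :=
  ⨅ y, U y + ((‖x - y‖ ^ 2 / (2 * α) : ℝ) : EReal)

theorem subdifferential_eq_iInter (U : X → EReal) (x : X) (r : ℝ) (hr : U x = r) :
    subdifferential U x = ⋂ y, {z | ((r + ⟪z, y - x⟫_ℝ : ℝ) : EReal) ≤ U y} := by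
  ext z
  simp [subdifferential, hr]

theorem isClosed_subdifferential (U : X → EReal) (x : X) (r : ℝ) (hr : U x = r) :
    IsClosed (subdifferential U x) := by
  rw [subdifferential_eq_iInter U x r hr]
  refine isClosed_iInter fun y => isClosed_le ?_ continuous_const
  exact continuous_coe_real_ereal.comp (by fun_prop)

theorem convex_subdifferential (U : X → EReal) (x : X) (r : ℝ) (hr : U x = r) :
    Convex ℝ (subdifferential U x) := by
  rw [subdifferential_eq_iInter U x r hr]
  refine convex_iInter fun y => ?_
  intro z hz w hw a b ha hb hab
  simp only [Set.mem_ofPred_eq] at hz hw ⊢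
  induction hU : U y with
  | bot => rw [hU] at hz; exact absurd (le_bot_iff.1 hz) (EReal.coe_ne_bot _)
  | top => exact le_top
  | coe s =>
    rw [hU] at hz hw
    rw [EReal.coe_le_coe_iff] at hz hw ⊢
    rw [inner_add_left, real_inner_smul_left, real_inner_smul_left]
    have h1 := mul_le_mul_of_nonneg_left hz ha
    have h2 := mul_le_mul_of_nonneg_left hw hb
    have hb' : b = 1 - a := by linarith
    subst hb'
    linarith

theorem minNormSubgradient_spec [CompleteSpace X] (U : X → EReal) (x : X) (hbot : U x ≠ ⊥)
    (h : (subdifferential U x).Nonempty) :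
    IsMinNormSubgradient U x (minNormSubgradient U x) := by
  have key : ∃ z, IsMinNormSubgradient U x z := by
    obtain ⟨z, hz⟩ := h
    have hr : U x = ((U x).toReal : ℝ) := (EReal.coe_toReal hz.1 hbot).symm
    obtain ⟨v, hv, hmin⟩ := exists_norm_eq_iInf_of_complete_convex ⟨z, hz⟩
      (isClosed_subdifferential U x _ hr).isComplete (convex_subdifferential U x _ hr) 0
    refine ⟨v, hv, fun w hw => ?_⟩
    have h2 : (⨅ w : subdifferential U x, ‖(0 : X) - w‖) ≤ ‖(0 : X) - w‖ :=
      ciInf_le ⟨0, by rintro _ ⟨i, rfl⟩; exact norm_nonneg _⟩ (⟨w, hw⟩ : subdifferential U x)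
    rw [← hmin] at h2
    simpa using h2
  unfold minNormSubgradient
  rw [dif_pos key]
  exact key.choose_spec

theorem IsMinNormSubgradient.eq_minNormSubgradient [CompleteSpace X] {U : X → EReal} {x z : X}
    (hbot : U x ≠ ⊥) (hz : IsMinNormSubgradient U x z) : z = minNormSubgradient U x := by
  have hw := minNormSubgradient_spec U x hbot ⟨z, hz.1⟩
  set w := minNormSubgradient U x
  have hr : U x = ((U x).toReal : ℝ) := (EReal.coe_toReal hz.1.1 hbot).symm
  have hm := hz.2 _ (convex_subdifferential U x _ hr hz.1 hw.1
    (show (0 : ℝ) ≤ 1 / 2 by norm_num) (show (0 : ℝ) ≤ 1 / 2 by norm_num) (by norm_num))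
  have he : ‖z‖ = ‖w‖ := le_antisymm (hz.2 _ hw.1) (hw.2 _ hz.1)
  rw [← smul_add, norm_smul, Real.norm_of_nonneg (by norm_num)] at hm
  have hp := parallelogram_law_with_norm ℝ z w
  have h0 := norm_nonneg z
  have : ‖z - w‖ * ‖z - w‖ ≤ 0 := by rw [← he] at hp; nlinarith
  exact sub_eq_zero.1 (norm_eq_zero.1 (mul_self_eq_zero.1 (le_antisymm this (mul_self_nonneg _))))

end Convex

section Sobolev

variable {X : Type*} [NormedAddCommGroup X] [InnerProductSpace ℝ X] [CompleteSpace X]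
  [MeasurableSpace X] {ι : Type*}

/-- `FC¹_b(X)`: the functions `x ↦ g(x_{i₁}, …, x_{iₙ})` of finitely many coordinates with respect
to the orthonormal basis `e`, where `g` is bounded and `C¹` with bounded first derivative. -/
def IsCylindricalC1b (e : HilbertBasis ι ℝ X) (φ : X → ℝ) : Prop :=
  ∃ (s : Finset ι) (g : (s → ℝ) → ℝ), ContDiff ℝ 1 g ∧
    (∃ C : ℝ, ∀ y, |g y| ≤ C ∧ ‖fderiv ℝ g y‖ ≤ C) ∧
    ∀ x, φ x = g (fun i => ⟪e i, x⟫_ℝ)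

/-- The power `Q^θ` of the operator `Q` with `Q e_k = lam k • e_k`:
`Q^θ z = ∑ₖ (lam k)^θ ⟨e_k, z⟩ e_k`. -/
noncomputable def powQ (e : HilbertBasis ι ℝ X) (lam : ι → ℝ) (θ : ℝ) (z : X) : X :=
  ∑' k, (lam k ^ θ * ⟪e k, z⟫_ℝ) • e k

/-- The pair `(u, G)` belongs to the graph of the closure in `L^p(X, μ) × L^p(X, μ; X)` of the
operator `Q^θ D : FC¹_b(X) → L^p(X, μ; X)`. -/
def HasSobolevGradient (μ : Measure X) (e : HilbertBasis ι ℝ X) (lam : ι → ℝ) (θ : ℝ) (p : ℝ≥0∞)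
    (u : X → ℝ) (G : X → X) : Prop :=
  MemLp u p μ ∧ MemLp G p μ ∧
    ∃ φ : ℕ → X → ℝ, (∀ n, IsCylindricalC1b e (φ n)) ∧
      Tendsto (fun n => eLpNorm (fun x => φ n x - u x) p μ) atTop (𝓝 0) ∧
      Tendsto (fun n => eLpNorm (fun x => powQ e lam θ (gradient (φ n) x) - G x) p μ)
        atTop (𝓝 0)

/-- `u ∈ W^{1,p}_θ(X, μ)`. -/
def MemSobolev (μ : Measure X) (e : HilbertBasis ι ℝ X) (lam : ι → ℝ) (θ : ℝ) (p : ℝ≥0∞)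
    (u : X → ℝ) : Prop :=
  ∃ G, HasSobolevGradient μ e lam θ p u G

open Classical in
/-- `Q^θ D u` for `u ∈ W^{1,p}_θ(X, μ)` (in particular `D u` if `θ = 0`). -/
noncomputable def sobolevGradient (μ : Measure X) (e : HilbertBasis ι ℝ X) (lam : ι → ℝ) (θ : ℝ)
    (p : ℝ≥0∞) (u : X → ℝ) : X → X :=
  if h : MemSobolev μ e lam θ p u then h.choose else 0

/-- The norm `(∫ |u|^p + ‖Q^θ D u‖^p dμ)^{1/p}` of `W^{1,p}_θ(X, μ)`, for `1 ≤ p < ∞`. -/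
noncomputable def sobolevNorm (μ : Measure X) (e : HilbertBasis ι ℝ X) (lam : ι → ℝ) (θ : ℝ)
    (p : ℝ≥0∞) (u : X → ℝ) : ℝ≥0∞ :=
  (eLpNorm u p μ ^ p.toReal + eLpNorm (sobolevGradient μ e lam θ p u) p μ ^ p.toReal)
    ^ (1 / p.toReal)

end Sobolev

end GaussSobolev

open GaussSobolev

set_option linter.unusedSectionVars false

/-! Everything is done for `U_α` first and then passed to the limit `α → 0⁺`.

Convex side. The infimum defining `U_α x` is attained at a point `J`, and `g_α x = (x - J) / α` is a
subgradient of `U` at `J`. Monotonicity of the subdifferential then yields the rest: `g_α` is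
`1/α`-Lipschitz, it is the gradient of `U_α`, `‖g_α x‖ ≤ ‖z‖` for every `z ∈ ∂U x`, and `‖g_α x‖`
grows as `α` decreases. Hence `g_α x` is Cauchy as `α → 0⁺`, and its limit is `D₀U x` wherever `∂U
x` is nonempty (`IsProperConvex.tendsto_yosida`). With `C ≤ U_α ≤ U` and `‖g_α‖ ≤ ‖D₀U‖`, dominated
convergence gives `U_α → U` and `g_α → D₀U` in `L^{p₀}`. That `U` itself lies in `L^{p₀}` follows
from `U x ≤ U x₀ + ⟨D₀U x, x - x₀⟩` and Hölder, the gap `p₀ < p₁` being paid for by Gaussian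
moments.

Gaussian side. `U_α` is `C¹` with gradient of linear growth, so cutting off and projecting to
finitely many coordinates puts `(U_α, g_α)` in the closed graph
(`hasSobolevGradient_of_hasGradientAt`); closedness then puts `(U, D₀U)` there. The identity `DU =
D₀U` also needs closability: integration by parts along each eigenvector `e_k` determines the
Fourier coefficients of a weighted `k`-th coordinate of any Sobolev gradient from `u` alone
(`HasSobolevGradient.unique`).

For `θ ≥ 0` the operator `Q^θ` is bounded, so the case `θ = 0` carries over by applying it. -/

namespace GaussSobolev

/-! ### Convex analysis: proximal points and Yosida approximation -/

section Prox

variable {X : Type*} [NormedAddCommGroup X] [InnerProductSpace ℝ X]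

theorem IsConvex.le_combination {U : X → EReal} (hconv : IsConvex U) {x y : X} {r s : ℝ}
    (hx : U x = r) (hy : U y = s) {a b : ℝ} (ha : 0 < a) (hb : 0 < b) (hab : a + b = 1) :
    U (a • x + b • y) ≤ ((a * r + b * s : ℝ) : EReal) := by
  have h := hconv x y a b ha hb hab
  rw [hx, hy] at h
  exact_mod_cast h

theorem exists_real_of_bounds {U : X → EReal} {C : ℝ} (hC : ∀ x, (C : EReal) ≤ U x) {y : X}
    (hy : U y ≠ ⊤) : ∃ r : ℝ, U y = r ∧ C ≤ r := by
  have h := hC y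
  induction hU : U y with
  | bot => rw [hU] at h; exact absurd (le_bot_iff.1 h) (EReal.coe_ne_bot _)
  | top => exact absurd hU hy
  | coe r => rw [hU] at h; exact ⟨r, rfl, EReal.coe_le_coe_iff.1 h⟩

theorem moreauYosida_le (U : X → EReal) (α : ℝ) (x y : X) {r : ℝ} (hr : U y = r) :
    moreauYosida U α x ≤ ((r + ‖x - y‖ ^ 2 / (2 * α) : ℝ) : EReal) := by
  refine (iInf_le _ y).trans ?_
  rw [hr, EReal.coe_add]

theorem exists_real_moreauYosida {U : X → EReal} {C : ℝ} (hC : ∀ x, (C : EReal) ≤ U x)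
    {x₀ : X} (hx₀ : U x₀ ≠ ⊤) {α : ℝ} (hα : 0 < α) (x : X) :
    ∃ m : ℝ, moreauYosida U α x = m ∧ C ≤ m := by
  obtain ⟨r, hr, -⟩ := exists_real_of_bounds hC hx₀
  have h1 := moreauYosida_le U α x x₀ hr
  have h2 : (C : EReal) ≤ moreauYosida U α x := by
    refine le_iInf fun y => ?_
    calc (C : EReal) = C + ((0 : ℝ) : EReal) := by simp
      _ ≤ _ := add_le_add (hC y) (by exact_mod_cast (by positivity))
  induction hm : moreauYosida U α x with
  | bot => rw [hm] at h2; exact absurd (le_bot_iff.1 h2) (EReal.coe_ne_bot _)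
  | top => rw [hm] at h1; exact absurd (top_le_iff.1 h1) (EReal.coe_ne_top _)
  | coe m => rw [hm] at h2; exact ⟨m, rfl, EReal.coe_le_coe_iff.1 h2⟩

/-- The parallelogram law. The term `-‖y - z‖² / 4` is the uniform convexity that makes minimizing
sequences Cauchy. -/
theorem norm_sub_midpoint_sq (x y z : X) :
    ‖x - ((1 / 2 : ℝ) • y + (1 / 2 : ℝ) • z)‖ ^ 2
      = (‖x - y‖ ^ 2 + ‖x - z‖ ^ 2) / 2 - ‖y - z‖ ^ 2 / 4 := by
  have h1 : x - ((1 / 2 : ℝ) • y + (1 / 2 : ℝ) • z) = (1 / 2 : ℝ) • ((x - y) + (x - z)) := by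
    module
  have h2 : y - z = (x - z) - (x - y) := by abel
  rw [h1, h2, norm_smul, mul_pow, norm_add_sq_real, norm_sub_sq_real (x - z),
    real_inner_comm (x - z)]
  norm_num
  ring

/-- The infimum defining the Moreau–Yosida approximation is attained. -/
theorem exists_isProx [CompleteSpace X] {U : X → EReal} (hconv : IsConvex U)
    (hlsc : LowerSemicontinuous U) {C : ℝ} (hC : ∀ x, (C : EReal) ≤ U x)
    {x₀ : X} (hx₀ : U x₀ ≠ ⊤) {α : ℝ} (hα : 0 < α) (x : X) :
    ∃ J : X, ∃ r : ℝ, U J = r ∧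
      moreauYosida U α x = ((r + ‖x - J‖ ^ 2 / (2 * α) : ℝ) : EReal) := by
  obtain ⟨m, hm, -⟩ := exists_real_moreauYosida hC hx₀ hα x
  have hmin : ∀ y (r : ℝ), U y ≤ r → m ≤ r + ‖x - y‖ ^ 2 / (2 * α) := by
    intro y r hr
    obtain ⟨s, hs, -⟩ := exists_real_of_bounds hC (ne_top_of_le_ne_top (EReal.coe_ne_top r) hr)
    have h := moreauYosida_le U α x y hs
    rw [hm, EReal.coe_le_coe_iff] at h
    rw [hs, EReal.coe_le_coe_iff] at hr
    linarith
  have hseq : ∀ n : ℕ, ∃ y : X, ∃ r : ℝ, U y = r ∧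
      r + ‖x - y‖ ^ 2 / (2 * α) < m + 1 / ((n : ℝ) + 1) := by
    intro n
    have h : moreauYosida U α x < ((m + 1 / ((n : ℝ) + 1) : ℝ) : EReal) := by
      rw [hm, EReal.coe_lt_coe_iff]
      have : 0 < 1 / ((n : ℝ) + 1) := by positivity
      linarith
    obtain ⟨y, hy⟩ := iInf_lt_iff.1 h
    have hyt : U y ≠ ⊤ := by
      rintro hU
      rw [hU, EReal.top_add_coe] at hy
      exact not_top_lt hy
    obtain ⟨r, hr, -⟩ := exists_real_of_bounds hC hyt
    rw [hr, ← EReal.coe_add, EReal.coe_lt_coe_iff] at hy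
    exact ⟨y, r, hr, hy⟩
  choose y r hr hy using hseq
  -- The midpoint of two near-minimizers cannot beat the infimum `m`, so the parallelogram gain is
  -- at most their mean excess.
  have hdist : ∀ n k, ‖y n - y k‖ ^ 2 ≤ 4 * α * (1 / ((n : ℝ) + 1) + 1 / ((k : ℝ) + 1)) := by
    intro n k
    have h1 := hconv.le_combination (hr n) (hr k) (a := 1 / 2) (b := 1 / 2) (by norm_num)
      (by norm_num) (by norm_num)
    have h2 := hmin _ _ h1
    rw [norm_sub_midpoint_sq] at h2
    have h3 := hy n
    have h4 := hy k
    have h5 : ‖y n - y k‖ ^ 2 / (8 * α) ≤ (1 / ((n : ℝ) + 1) + 1 / ((k : ℝ) + 1)) / 2 := by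
      have : ((‖x - y n‖ ^ 2 + ‖x - y k‖ ^ 2) / 2 - ‖y n - y k‖ ^ 2 / 4) / (2 * α)
        = (‖x - y n‖ ^ 2 / (2 * α) + ‖x - y k‖ ^ 2 / (2 * α)) / 2 - ‖y n - y k‖ ^ 2 / (8 * α) := by
        field_simp; ring
      rw [this] at h2
      linarith
    rw [div_le_iff₀ (by positivity)] at h5
    linarith
  have hcauchy : CauchySeq y := by
    -- For `n, k ≥ N` both fractions are at most `1 / (N + 1)`, whence `8 = 4 · 2`.
    have hlim : Tendsto (fun n : ℕ => √(8 * α * (1 / ((n : ℝ) + 1)))) atTop (𝓝 0) := by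
      have := (tendsto_one_div_add_atTop_nhds_zero_nat (𝕜 := ℝ)).const_mul (8 * α)
      simpa using this.sqrt
    refine cauchySeq_of_le_tendsto_0 _ (fun n k N hn hk => ?_) hlim
    rw [dist_eq_norm]
    refine Real.le_sqrt_of_sq_le ((hdist n k).trans ?_)
    have h1 := Nat.one_div_le_one_div (α := ℝ) hn
    have h2 := Nat.one_div_le_one_div (α := ℝ) hk
    nlinarith
  obtain ⟨J, hJ⟩ := cauchySeq_tendsto_of_complete hcauchy
  have hq : Tendsto (fun n => ‖x - y n‖ ^ 2 / (2 * α)) atTop (𝓝 (‖x - J‖ ^ 2 / (2 * α))) :=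
    ((tendsto_const_nhds.sub hJ).norm.pow 2).div_const _
  have hUJ : U J ≤ ((m - ‖x - J‖ ^ 2 / (2 * α) : ℝ) : EReal) := by
    by_contra! hlt
    -- Lower semicontinuity keeps `U (y n)` above `c` eventually, against the limit of the
    -- near-minimality bounds.
    obtain ⟨c, hc1, hc2⟩ := EReal.lt_iff_exists_real_btwn.1 hlt
    have hev := hJ.eventually (hlsc J c hc2)
    have hbound : ∀ᶠ n : ℕ in atTop, c ≤ m + 1 / ((n : ℝ) + 1) - ‖x - y n‖ ^ 2 / (2 * α) := by
      filter_upwards [hev] with n hn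
      rw [hr n, gt_iff_lt, EReal.coe_lt_coe_iff] at hn
      linarith [hy n]
    have hlim : Tendsto (fun n : ℕ => m + 1 / (((n : ℕ) : ℝ) + 1) - ‖x - y n‖ ^ 2 / (2 * α)) atTop
        (𝓝 (m + 0 - ‖x - J‖ ^ 2 / (2 * α))) :=
      (tendsto_const_nhds.add tendsto_one_div_add_atTop_nhds_zero_nat).sub hq
    have hge := ge_of_tendsto hlim hbound
    rw [EReal.coe_lt_coe_iff] at hc1
    linarith
  obtain ⟨s, hs, -⟩ := exists_real_of_bounds hC (ne_top_of_le_ne_top (EReal.coe_ne_top _) hUJ)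
  refine ⟨J, s, hs, ?_⟩
  rw [hm]
  have h1 := hmin J s hs.le
  rw [hs, EReal.coe_le_coe_iff] at hUJ
  congr 1
  linarith

/-- The proximal point: a minimizer in the definition of `moreauYosida U α x`. -/
noncomputable def prox (U : X → EReal) (α : ℝ) (x : X) : X :=
  Classical.epsilon fun J => ∃ r : ℝ, U J = r ∧
      moreauYosida U α x = ((r + ‖x - J‖ ^ 2 / (2 * α) : ℝ) : EReal)

/-- The Yosida approximation `(x - prox x) / α` of the subdifferential. -/
noncomputable def yosida (U : X → EReal) (α : ℝ) (x : X) : X :=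
  α⁻¹ • (x - prox U α x)

/-- A proper convex lower semicontinuous function which is bounded from below. -/
structure IsProperConvex (U : X → EReal) : Prop where
  convex : IsConvex U
  lsc : LowerSemicontinuous U
  bddBelow : ∃ C : ℝ, ∀ x, (C : EReal) ≤ U x
  proper : ∃ x, U x ≠ ⊤

theorem IsProperConvex.ne_bot {U : X → EReal} (hU : IsProperConvex U) (x : X) : U x ≠ ⊥ := by
  obtain ⟨C, hC⟩ := hU.bddBelow
  exact fun h => absurd (le_bot_iff.1 (h ▸ hC x)) (EReal.coe_ne_bot _)

theorem IsProperConvex.coe_toReal {U : X → EReal} (hU : IsProperConvex U) {x : X}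
    (hx : U x ≠ ⊤) : U x = ((U x).toReal : ℝ) := (EReal.coe_toReal hx (hU.ne_bot x)).symm

theorem mem_subdifferential_real {U : X → EReal} {x z : X} {r : ℝ} (hr : U x = r)
    (hz : z ∈ subdifferential U x) {y : X} {s : ℝ} (hs : U y = s) :
    r + ⟪z, y - x⟫_ℝ ≤ s := by
  have h := hz.2 y
  rw [hr, hs] at h
  exact_mod_cast h

theorem mem_subdifferential_of_real {U : X → EReal} (hU : IsProperConvex U) {x z : X} {r : ℝ}
    (hr : U x = r) (h : ∀ y (s : ℝ), U y = s → r + ⟪z, y - x⟫_ℝ ≤ s) :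
    z ∈ subdifferential U x := by
  refine ⟨hr ▸ EReal.coe_ne_top r, fun y => ?_⟩
  by_cases hy : U y = ⊤
  · rw [hy]; exact le_top
  · rw [hr, hU.coe_toReal hy]
    exact_mod_cast h y _ (hU.coe_toReal hy)

variable [CompleteSpace X] {U : X → EReal}

theorem IsProperConvex.prox_spec (hU : IsProperConvex U) {α : ℝ} (hα : 0 < α) (x : X) :
    ∃ r : ℝ, U (prox U α x) = r ∧
      moreauYosida U α x = ((r + ‖x - prox U α x‖ ^ 2 / (2 * α) : ℝ) : EReal) := by
  obtain ⟨C, hC⟩ := hU.bddBelow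
  obtain ⟨x₀, hx₀⟩ := hU.proper
  exact Classical.epsilon_spec (exists_isProx hU.convex hU.lsc hC hx₀ hα x)

theorem sub_prox (U : X → EReal) {α : ℝ} (hα : 0 < α) (x : X) :
    x - prox U α x = α • yosida U α x := by
  rw [yosida, smul_smul, mul_inv_cancel₀ hα.ne', one_smul]

theorem prox_eq (U : X → EReal) {α : ℝ} (hα : 0 < α) (x : X) :
    prox U α x = x - α • yosida U α x := by
  rw [← sub_prox U hα]; abel

theorem IsProperConvex.prox_ne_top (hU : IsProperConvex U) {α : ℝ} (hα : 0 < α) (x : X) :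
    U (prox U α x) ≠ ⊤ := by
  obtain ⟨r, hr, -⟩ := hU.prox_spec hα x
  rw [hr]; exact EReal.coe_ne_top r

theorem IsProperConvex.moreauYosida_coe_toReal (hU : IsProperConvex U) {α : ℝ} (hα : 0 < α)
    (x : X) : moreauYosida U α x = ((moreauYosida U α x).toReal : ℝ) := by
  obtain ⟨r, -, h⟩ := hU.prox_spec hα x
  rw [h, EReal.toReal_coe]

theorem IsProperConvex.toReal_moreauYosida_eq (hU : IsProperConvex U) {α : ℝ} (hα : 0 < α)
    (x : X) : (moreauYosida U α x).toReal
      = (U (prox U α x)).toReal + α / 2 * ‖yosida U α x‖ ^ 2 := by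
  obtain ⟨r, hr, h⟩ := hU.prox_spec hα x
  rw [h, hr, EReal.toReal_coe, EReal.toReal_coe, sub_prox U hα, norm_smul,
    Real.norm_of_nonneg hα.le]
  field_simp

/-- Fermat's rule for the minimizer: compare `J` with `(1 - t) J + t y`. Convexity makes the change
of `U` at most linear in `t`, the quadratic term contributes `-t ⟨g, y - J⟩ + O(t²)`; divide by `t`
and let `t → 0⁺`. -/
theorem IsProperConvex.yosida_mem (hU : IsProperConvex U) {α : ℝ} (hα : 0 < α) (x : X) :
    yosida U α x ∈ subdifferential U (prox U α x) := by
  obtain ⟨r, hr, h⟩ := hU.prox_spec hα x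
  refine mem_subdifferential_of_real hU hr fun y s hs => ?_
  set J := prox U α x
  set g := yosida U α x
  have key : ∀ t : ℝ, 0 < t → t < 1 → r + ⟪g, y - J⟫_ℝ - s ≤ t * (‖y - J‖ ^ 2 / (2 * α)) := by
    intro t h0 h1
    have hc := hU.convex.le_combination hr hs (a := 1 - t) (b := t) (by linarith) h0 (by ring)
    have hz : U ((1 - t) • J + t • y) ≠ ⊤ := ne_top_of_le_ne_top (EReal.coe_ne_top _) hc
    have hm := moreauYosida_le U α x _ (hU.coe_toReal hz)
    rw [hU.coe_toReal hz, EReal.coe_le_coe_iff] at hc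
    rw [h, EReal.coe_le_coe_iff] at hm
    have e1 : x - ((1 - t) • J + t • y) = (x - J) - t • (y - J) := by module
    have e2 : x - J = α • g := sub_prox U hα x
    rw [e1, e2, norm_sub_sq_real, real_inner_smul_left, real_inner_smul_right, norm_smul t,
      Real.norm_of_nonneg h0.le] at hm
    have e3 : (‖α • g‖ ^ 2 - 2 * (α * (t * ⟪g, y - J⟫_ℝ)) + (t * ‖y - J‖) ^ 2) / (2 * α)
        = ‖α • g‖ ^ 2 / (2 * α) - t * ⟪g, y - J⟫_ℝ + t * (t * (‖y - J‖ ^ 2 / (2 * α))) := by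
      field_simp
    rw [e3] at hm
    have : t * (r + ⟪g, y - J⟫_ℝ - s) ≤ t * (t * (‖y - J‖ ^ 2 / (2 * α))) := by linarith
    exact le_of_mul_le_mul_left this h0
  have hlim : Tendsto (fun t : ℝ => t * (‖y - J‖ ^ 2 / (2 * α))) (𝓝[>] 0)
      (𝓝 (0 * (‖y - J‖ ^ 2 / (2 * α)))) :=
    (tendsto_nhdsWithin_of_tendsto_nhds tendsto_id).mul_const _
  have := ge_of_tendsto hlim (by
    filter_upwards [Ioo_mem_nhdsGT (show (0 : ℝ) < 1 by norm_num)] with t ht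
    exact key t ht.1 ht.2)
  linarith

theorem subdifferential_monotone (hU : IsProperConvex U) {x y z w : X}
    (hz : z ∈ subdifferential U x) (hw : w ∈ subdifferential U y) :
    0 ≤ ⟪z - w, x - y⟫_ℝ := by
  have h1 := mem_subdifferential_real (hU.coe_toReal hz.1) hz (hU.coe_toReal hw.1)
  have h2 := mem_subdifferential_real (hU.coe_toReal hw.1) hw (hU.coe_toReal hz.1)
  rw [← neg_sub x y, inner_neg_right] at h1
  rw [inner_sub_left]
  linarith

/-- Monotonicity between `x` and its proximal point, where `x - J = α g`, reads `‖g‖² ≤ ⟨z, g⟩`. -/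
theorem IsProperConvex.norm_yosida_le (hU : IsProperConvex U) {α : ℝ} (hα : 0 < α) {x z : X}
    (hz : z ∈ subdifferential U x) : ‖yosida U α x‖ ≤ ‖z‖ := by
  have h := subdifferential_monotone hU hz (hU.yosida_mem hα x)
  rw [sub_prox U hα, real_inner_smul_right, inner_sub_left, real_inner_self_eq_norm_sq] at h
  have h1 := nonneg_of_mul_nonneg_right h hα
  have h2 := real_inner_le_norm z (yosida U α x)
  by_contra! hlt
  nlinarith [norm_nonneg z, norm_nonneg (yosida U α x)]

/-- The subgradient inequality between the two proximal points, with `J = x - α g` substituted and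
the square completed. The quadratic surplus yields both the Lipschitz bound on `g` and the
differentiability of `U_α`. -/
theorem IsProperConvex.moreauYosida_ge (hU : IsProperConvex U) {α : ℝ} (hα : 0 < α) (x y : X) :
    (moreauYosida U α x).toReal + ⟪yosida U α x, y - x⟫_ℝ
      + α / 2 * ‖yosida U α y - yosida U α x‖ ^ 2 ≤ (moreauYosida U α y).toReal := by
  rw [hU.toReal_moreauYosida_eq hα, hU.toReal_moreauYosida_eq hα]
  have h := mem_subdifferential_real (hU.coe_toReal (hU.prox_ne_top hα x)) (hU.yosida_mem hα x)
    (hU.coe_toReal (hU.prox_ne_top hα y))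
  have e : prox U α y - prox U α x = (y - x) - α • (yosida U α y - yosida U α x) := by
    rw [prox_eq U hα, prox_eq U hα]; module
  rw [e, inner_sub_right, real_inner_smul_right, inner_sub_right (yosida U α x) (yosida U α y),
    real_inner_self_eq_norm_sq] at h
  rw [norm_sub_sq_real, real_inner_comm (yosida U α x) (yosida U α y)]
  linarith

/-- Adding `moreauYosida_ge` to itself with `x` and `y` exchanged gives cocoercivity, `α ‖g y - g
x‖² ≤ ⟨g y - g x, y - x⟩`. -/
theorem IsProperConvex.norm_yosida_sub_le (hU : IsProperConvex U) {α : ℝ} (hα : 0 < α) (x y : X) :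
    ‖yosida U α y - yosida U α x‖ ≤ α⁻¹ * ‖y - x‖ := by
  have h1 := hU.moreauYosida_ge hα x y
  have h2 := hU.moreauYosida_ge hα y x
  rw [norm_sub_rev (yosida U α x), ← neg_sub y x, inner_neg_right] at h2
  have h3 := real_inner_le_norm (yosida U α y - yosida U α x) (y - x)
  rw [inner_sub_left] at h3
  rw [inv_mul_eq_div, le_div_iff₀ hα]
  set n := ‖yosida U α y - yosida U α x‖
  by_contra! hlt
  nlinarith [norm_nonneg (yosida U α y - yosida U α x), norm_nonneg (y - x)]

theorem IsProperConvex.continuous_yosida (hU : IsProperConvex U) {α : ℝ} (hα : 0 < α) :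
    Continuous (yosida U α) := by
  refine (LipschitzWith.of_dist_le_mul (K := ⟨α⁻¹, by positivity⟩) fun x y => ?_).continuous
  rw [dist_eq_norm, dist_eq_norm]
  exact hU.norm_yosida_sub_le hα y x

theorem IsProperConvex.hasGradientAt_moreauYosida (hU : IsProperConvex U) {α : ℝ} (hα : 0 < α)
    (x : X) :
    HasGradientAt (fun x => (moreauYosida U α x).toReal) (yosida U α x) x := by
  rw [hasGradientAt_iff_isLittleO]
  have hO : (fun y => (moreauYosida U α y).toReal - (moreauYosida U α x).toReal
      - ⟪yosida U α x, y - x⟫_ℝ) =O[𝓝 x] fun y => ‖y - x‖ ^ 2 := by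
    refine Asymptotics.IsBigO.of_bound α⁻¹ (Eventually.of_forall fun y => ?_)
    have h1 := hU.moreauYosida_ge hα x y
    have h2 := hU.moreauYosida_ge hα y x
    have h3 := real_inner_le_norm (yosida U α y - yosida U α x) (y - x)
    have h4 := mul_le_mul_of_nonneg_right (hU.norm_yosida_sub_le hα x y) (norm_nonneg (y - x))
    rw [← neg_sub y x, inner_neg_right] at h2
    rw [inner_sub_left] at h3
    rw [Real.norm_eq_abs, Real.norm_eq_abs, abs_of_nonneg (by positivity : 0 ≤ ‖y - x‖ ^ 2), abs_le]
    have h5 : 0 ≤ α / 2 * ‖yosida U α y - yosida U α x‖ ^ 2 := by positivity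
    have h6 : 0 ≤ α / 2 * ‖yosida U α x - yosida U α y‖ ^ 2 := by positivity
    -- The remainder lies between `0` and `⟨g y - g x, y - x⟩ ≤ α⁻¹ ‖y - x‖²`.
    constructor <;> nlinarith [sq_nonneg ‖y - x‖]
  refine hO.trans_isLittleO ?_
  have : (fun y : X => ‖y - x‖ ^ 2) =o[𝓝 x] fun y => (y - x) := by
    have h := Asymptotics.isLittleO_norm_pow_id (E' := X) (n := 2) (by norm_num)
    exact h.comp_tendsto (k := fun y => y - x) (by
      have : Tendsto (fun y => y - x) (𝓝 x) (𝓝 (x - x)) := tendsto_id.sub tendsto_const_nhds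
      simpa using this)
  exact this

theorem IsProperConvex.toReal_moreauYosida_le (hU : IsProperConvex U) {α : ℝ} (hα : 0 < α) {x : X}
    (hx : U x ≠ ⊤) : (moreauYosida U α x).toReal ≤ (U x).toReal := by
  have h := moreauYosida_le U α x x (hU.coe_toReal hx)
  rw [hU.moreauYosida_coe_toReal hα, EReal.coe_le_coe_iff] at h
  simpa using h

theorem le_toReal_moreauYosida (hU : IsProperConvex U) {C : ℝ} (hC : ∀ x, (C : EReal) ≤ U x)
    {α : ℝ} (hα : 0 < α) (x : X) : C ≤ (moreauYosida U α x).toReal := by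
  obtain ⟨x₀, hx₀⟩ := hU.proper
  obtain ⟨m, hm, h⟩ := exists_real_moreauYosida hC hx₀ hα x
  rwa [hm, EReal.toReal_coe]

theorem IsProperConvex.toReal_moreauYosida_ge (hU : IsProperConvex U) {α : ℝ} (hα : 0 < α)
    {x z : X} (hz : z ∈ subdifferential U x) :
    (U x).toReal - α * ‖z‖ ^ 2 ≤ (moreauYosida U α x).toReal := by
  have h := mem_subdifferential_real (hU.coe_toReal hz.1) hz (hU.coe_toReal (hU.prox_ne_top hα x))
  rw [hU.toReal_moreauYosida_eq hα]
  have e : prox U α x - x = -(α • yosida U α x) := by rw [prox_eq U hα]; abel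
  rw [e, inner_neg_right, real_inner_smul_right] at h
  have h1 := real_inner_le_norm z (yosida U α x)
  have h2 := hU.norm_yosida_le hα hz
  have h3 : ‖z‖ * ‖yosida U α x‖ ≤ ‖z‖ ^ 2 := by nlinarith [norm_nonneg z]
  have h4 : α * ⟪z, yosida U α x⟫_ℝ ≤ α * ‖z‖ ^ 2 :=
    mul_le_mul_of_nonneg_left (h1.trans h3) hα.le
  have h5 : 0 ≤ α / 2 * ‖yosida U α x‖ ^ 2 := by positivity
  linarith

theorem IsProperConvex.tendsto_moreauYosida (hU : IsProperConvex U) {x : X}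
    (hx : (subdifferential U x).Nonempty) :
    Tendsto (fun α => (moreauYosida U α x).toReal) (𝓝[>] 0) (𝓝 (U x).toReal) := by
  obtain ⟨z, hz⟩ := hx
  have hlim : Tendsto (fun α : ℝ => (U x).toReal - α * ‖z‖ ^ 2) (𝓝[>] 0) (𝓝 (U x).toReal) := by
    have h : Tendsto (fun α : ℝ => (U x).toReal - α * ‖z‖ ^ 2) (𝓝 0)
        (𝓝 ((U x).toReal - 0 * ‖z‖ ^ 2)) := Continuous.tendsto (by fun_prop) 0
    rw [zero_mul, sub_zero] at h
    exact h.mono_left nhdsWithin_le_nhds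
  refine tendsto_of_tendsto_of_tendsto_of_le_of_le' hlim tendsto_const_nhds ?_ ?_
  · filter_upwards [self_mem_nhdsWithin] with α hα using hU.toReal_moreauYosida_ge hα hz
  · filter_upwards [self_mem_nhdsWithin] with α hα using hU.toReal_moreauYosida_le hα hz.1

/-- Monotonicity between the two proximal points of the same `x` gives `α a + β b ≤ (α + β) c`, with
`a`, `b` the squared norms and `c` the inner product. This forces `b ≤ a`, then `b ≤ c`, and the
claim is `b ≤ c` rearranged. -/
theorem IsProperConvex.yosida_sub_sq_le (hU : IsProperConvex U) {α β : ℝ} (hα : 0 < α)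
    (hαβ : α ≤ β) (x : X) :
    ‖yosida U α x - yosida U β x‖ ^ 2 ≤ ‖yosida U α x‖ ^ 2 - ‖yosida U β x‖ ^ 2 := by
  have hβ : 0 < β := hα.trans_le hαβ
  have h := subdifferential_monotone hU (hU.yosida_mem hα x) (hU.yosida_mem hβ x)
  have e : prox U α x - prox U β x = β • yosida U β x - α • yosida U α x := by
    rw [prox_eq U hα, prox_eq U hβ]; abel
  rw [e, inner_sub_left, inner_sub_right, inner_sub_right, real_inner_smul_right,
    real_inner_smul_right, real_inner_smul_right, real_inner_smul_right,
    real_inner_self_eq_norm_sq, real_inner_self_eq_norm_sq,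
    real_inner_comm (yosida U α x) (yosida U β x)] at h
  have hs := norm_sub_sq_real (yosida U α x) (yosida U β x)
  have hn := sq_nonneg ‖yosida U α x - yosida U β x‖
  set a := ‖yosida U α x‖ ^ 2
  set b := ‖yosida U β x‖ ^ 2
  set c := ⟪yosida U α x, yosida U β x⟫_ℝ
  rw [hs] at hn ⊢
  have h' : α * a + β * b ≤ (α + β) * c := by linarith
  rcases hαβ.eq_or_lt with rfl | hlt
  · nlinarith
  have hab : 0 ≤ a - b := by
    refine nonneg_of_mul_nonneg_right (a := β - α) ?_ (by linarith)
    nlinarith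
  have hcb : 0 ≤ c - b := by
    refine nonneg_of_mul_nonneg_right (a := α + β) ?_ (by linarith)
    nlinarith [mul_nonneg hα.le hab]
  linarith

/-- The Yosida approximations converge to the element of minimal norm of the subdifferential. -/
theorem IsProperConvex.tendsto_yosida (hU : IsProperConvex U) {x : X}
    (hx : (subdifferential U x).Nonempty) :
    Tendsto (fun α => yosida U α x) (𝓝[>] 0) (𝓝 (minNormSubgradient U x)) := by
  have hmin := minNormSubgradient_spec U x (hU.ne_bot x) hx
  obtain ⟨z, hz⟩ := hx
  set S := (fun α => ‖yosida U α x‖ ^ 2) '' Set.Ioi (0 : ℝ)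
  have hSb : BddAbove S := by
    refine ⟨‖z‖ ^ 2, ?_⟩
    rintro _ ⟨α, hα, rfl⟩
    exact pow_le_pow_left₀ (norm_nonneg _) (hU.norm_yosida_le hα hz) 2
  have hSn : S.Nonempty := ⟨_, 1, by simp, rfl⟩
  have hcauchy : Cauchy (map (fun α => yosida U α x) (𝓝[>] 0)) := by
    refine Metric.cauchy_iff.2 ⟨inferInstance, fun ε hε => ?_⟩
    -- Once `‖g_β‖²` is within `(ε / 3)²` of the supremum, every `g_α` with `α ≤ β` is within `ε /
    -- 3` of `g_β`.
    obtain ⟨_, ⟨β, hβ, rfl⟩, hlt⟩ := exists_lt_of_lt_csSup hSn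
      (show sSup S - (ε / 3) ^ 2 < sSup S by have : 0 < (ε / 3) ^ 2 := by positivity
                                             linarith)
    refine ⟨_, image_mem_map (Ioc_mem_nhdsGT (show (0 : ℝ) < β from hβ)), ?_⟩
    have hd : ∀ α ∈ Set.Ioc 0 β, dist (yosida U α x) (yosida U β x) < ε / 2 := by
      intro α hα
      have h1 := hU.yosida_sub_sq_le hα.1 hα.2 x
      have h2 : ‖yosida U α x‖ ^ 2 ≤ sSup S := le_csSup hSb ⟨α, hα.1, rfl⟩
      have h3 : ‖yosida U α x - yosida U β x‖ ^ 2 < (ε / 3) ^ 2 := by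
        simp only at hlt
        linarith
      have := lt_of_pow_lt_pow_left₀ 2 (by positivity) h3
      rw [dist_eq_norm]
      linarith
    rintro _ ⟨a, ha, rfl⟩ _ ⟨b, hb, rfl⟩
    have := dist_triangle_right (yosida U a x) (yosida U b x) (yosida U β x)
    linarith [hd a ha, hd b hb]
  obtain ⟨w, hw⟩ := CompleteSpace.complete hcauchy
  have hw : Tendsto (fun α => yosida U α x) (𝓝[>] 0) (𝓝 w) := hw
  have hid : Tendsto (fun α : ℝ => α) (𝓝[>] 0) (𝓝 0) :=
    tendsto_nhdsWithin_of_tendsto_nhds tendsto_id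
  suffices h : IsMinNormSubgradient U x w by
    rwa [← h.eq_minNormSubgradient (hU.ne_bot x)]
  refine ⟨mem_subdifferential_of_real hU (hU.coe_toReal hz.1) fun y s hs => ?_, fun v hv => ?_⟩
  -- `U` at the proximal point is written as `U_α x - α/2 ‖g_α‖²`, whose limit is known, so its
  -- subgradient inequality passes to the limit.
  · have hlim : Tendsto (fun α => (moreauYosida U α x).toReal - α / 2 * ‖yosida U α x‖ ^ 2
        + ⟪yosida U α x, y - (x - α • yosida U α x)⟫_ℝ) (𝓝[>] 0)
        (𝓝 ((U x).toReal - 0 / 2 * ‖w‖ ^ 2 + ⟪w, y - (x - (0 : ℝ) • w)⟫_ℝ)) :=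
      ((hU.tendsto_moreauYosida ⟨z, hz⟩).sub ((hid.div_const 2).mul (hw.norm.pow 2))).add
        (hw.inner (tendsto_const_nhds.sub (tendsto_const_nhds.sub (hid.smul hw))))
    have hle : (U x).toReal - 0 / 2 * ‖w‖ ^ 2 + ⟪w, y - (x - (0 : ℝ) • w)⟫_ℝ ≤ s := by
      refine le_of_tendsto hlim ?_
      filter_upwards [self_mem_nhdsWithin] with α hα
      have h := mem_subdifferential_real (hU.coe_toReal (hU.prox_ne_top hα x))
        (hU.yosida_mem hα x) hs
      rw [hU.toReal_moreauYosida_eq hα, ← prox_eq U hα]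
      linarith
    simpa using hle
  · refine le_of_tendsto hw.norm ?_
    filter_upwards [self_mem_nhdsWithin] with α hα using hU.norm_yosida_le hα hv

end Prox

/-! ### Diagonal operators and the powers of `Q` -/

section Operators

variable {X : Type*} [NormedAddCommGroup X] [InnerProductSpace ℝ X] [CompleteSpace X]
  {ι : Type*}

theorem hasSum_inner_sq (e : HilbertBasis ι ℝ X) (z : X) :
    HasSum (fun k => ⟪e k, z⟫_ℝ ^ 2) (‖z‖ ^ 2) := by
  have h := e.hasSum_inner_mul_inner z z
  rw [real_inner_self_eq_norm_sq] at h
  refine h.congr_fun fun k => ?_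
  rw [real_inner_comm (e k) z, sq]

/-- A bounded diagonal operator with respect to a Hilbert basis. -/
theorem exists_diagonal (e : HilbertBasis ι ℝ X) (c : ι → ℝ) {M : ℝ} (hM : ∀ k, |c k| ≤ M) :
    ∃ T : X →L[ℝ] X, (∀ z, HasSum (fun k => (c k * ⟪e k, z⟫_ℝ) • e k) (T z)) ∧
      ∀ k z, ⟪e k, T z⟫_ℝ = c k * ⟪e k, z⟫_ℝ := by
  -- `|M|` replaces `M`, which may be negative when `ι` is empty.
  have hM0 : 0 ≤ |M| := abs_nonneg M
  have hbound : ∀ z k, (c k * ⟪e k, z⟫_ℝ) ^ 2 ≤ |M| ^ 2 * ⟪e k, z⟫_ℝ ^ 2 := by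
    intro z k
    rw [mul_pow]
    refine mul_le_mul_of_nonneg_right ?_ (sq_nonneg _)
    exact sq_le_sq.2 ((hM k).trans ((le_abs_self M).trans (le_abs_self _)))
  have hmem : ∀ z, Memℓp (fun k => c k * ⟪e k, z⟫_ℝ) 2 := by
    intro z
    refine memℓp_gen ?_
    have h := ((hasSum_inner_sq e z).summable.mul_left (|M| ^ 2))
    refine h.of_nonneg_of_le (fun k => by positivity) fun k => ?_
    simpa [mul_pow] using hbound z k
  have hs : ∀ z, HasSum (fun k => (c k * ⟪e k, z⟫_ℝ) • e k) (e.repr.symm ⟨_, hmem z⟩) :=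
    fun z => e.hasSum_repr_symm ⟨_, hmem z⟩
  have hc : ∀ k z, ⟪e k, e.repr.symm ⟨_, hmem z⟩⟫_ℝ = c k * ⟪e k, z⟫_ℝ := by
    intro k z
    rw [← e.repr_apply_apply, LinearIsometryEquiv.apply_symm_apply]
  let T : X →ₗ[ℝ] X :=
    { toFun := fun z => e.repr.symm ⟨_, hmem z⟩
      map_add' := fun x y => (hs (x + y)).unique <| by
        refine ((hs x).add (hs y)).congr_fun fun k => ?_
        rw [inner_add_right, mul_add, add_smul]
      map_smul' := fun a x => (hs (a • x)).unique <| by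
        refine ((hs x).const_smul a).congr_fun fun k => ?_
        rw [real_inner_smul_right, smul_smul]
        ring_nf }
  refine ⟨T.mkContinuous |M| fun z => ?_, hs, hc⟩
  refine le_of_sq_le_sq ?_ (by positivity)
  rw [mul_pow]
  refine hasSum_le (fun k => ?_) (hasSum_inner_sq e (T z))
    ((hasSum_inner_sq e z).mul_left (|M| ^ 2))
  have : ⟪e k, T z⟫_ℝ = c k * ⟪e k, z⟫_ℝ := hc k z
  rw [this]
  exact hbound z k

theorem exists_powQ_clm (e : HilbertBasis ι ℝ X) {lam : ι → ℝ} (hlam : ∀ k, 0 < lam k) {B : ℝ}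
    (hB : ∀ k, lam k ≤ B) {θ : ℝ} (hθ : 0 ≤ θ) :
    ∃ T : X →L[ℝ] X, (∀ z, powQ e lam θ z = T z) ∧
      ∀ k z, ⟪e k, powQ e lam θ z⟫_ℝ = lam k ^ θ * ⟪e k, z⟫_ℝ := by
  obtain ⟨T, hT, hT'⟩ := exists_diagonal e (fun k => lam k ^ θ) (M := B ^ θ) (fun k => by
    rw [abs_of_nonneg (Real.rpow_nonneg (hlam k).le _)]
    exact Real.rpow_le_rpow (hlam k).le (hB k) hθ)
  have h : ∀ z, powQ e lam θ z = T z := fun z => (hT z).tsum_eq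
  exact ⟨T, h, fun k z => by rw [h, hT']⟩

theorem powQ_zero (e : HilbertBasis ι ℝ X) (lam : ι → ℝ) (z : X) : powQ e lam 0 z = z := by
  refine HasSum.tsum_eq ?_
  refine (e.hasSum_repr z).congr_fun fun k => ?_
  rw [Real.rpow_zero, one_mul, e.repr_apply_apply]

end Operators

/-! ### Cylindrical functions -/

section Cylindrical

variable {X : Type*} [NormedAddCommGroup X] [InnerProductSpace ℝ X] [CompleteSpace X]
  {ι : Type*} {e : HilbertBasis ι ℝ X} {φ ψ : X → ℝ}

/-- The coordinates with indices in a finite set. -/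
noncomputable def coordinates (e : HilbertBasis ι ℝ X) (s : Finset ι) : X →L[ℝ] (s → ℝ) :=
  ContinuousLinearMap.pi fun i => innerSL ℝ (e i)

theorem coordinates_apply (e : HilbertBasis ι ℝ X) (s : Finset ι) (x : X) (i : s) :
    coordinates e s x i = ⟪e i, x⟫_ℝ := rfl

theorem isCylindricalC1b_iff : IsCylindricalC1b e φ ↔
    ∃ (s : Finset ι) (g : (s → ℝ) → ℝ), ContDiff ℝ 1 g ∧
      (∃ C : ℝ, ∀ y, |g y| ≤ C ∧ ‖fderiv ℝ g y‖ ≤ C) ∧ φ = g ∘ coordinates e s := by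
  simp only [IsCylindricalC1b, funext_iff]
  rfl

theorem IsCylindricalC1b.contDiff (h : IsCylindricalC1b e φ) : ContDiff ℝ 1 φ := by
  obtain ⟨s, g, hg, -, rfl⟩ := isCylindricalC1b_iff.1 h
  exact hg.comp (coordinates e s).contDiff

theorem norm_gradient (φ : X → ℝ) (x : X) : ‖gradient φ x‖ = ‖fderiv ℝ φ x‖ := by
  rw [gradient, LinearIsometryEquiv.norm_map]

theorem continuous_gradient (h : ContDiff ℝ 1 φ) : Continuous (gradient φ) :=
  (InnerProductSpace.toDual ℝ X).symm.continuous.comp (h.continuous_fderiv one_ne_zero)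

theorem inner_gradient (h : ContDiff ℝ 1 φ) (x y : X) :
    ⟪gradient φ x, y⟫_ℝ = fderiv ℝ φ x y :=
  ((h.differentiable one_ne_zero x).hasGradientAt.fderiv_apply).symm

theorem gradient_sub (hφ : ContDiff ℝ 1 φ) (hψ : ContDiff ℝ 1 ψ) (x : X) :
    gradient (fun x => φ x - ψ x) x = gradient φ x - gradient ψ x := by
  rw [gradient, gradient, gradient, ← map_sub,
    ← fderiv_fun_sub (hφ.differentiable one_ne_zero x) (hψ.differentiable one_ne_zero x)]

theorem IsCylindricalC1b.exists_bound (h : IsCylindricalC1b e φ) :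
    ∃ C : ℝ, ∀ x, |φ x| ≤ C ∧ ‖gradient φ x‖ ≤ C := by
  obtain ⟨s, g, hg, ⟨C, hC⟩, rfl⟩ := isCylindricalC1b_iff.1 h
  refine ⟨max C (C * ‖coordinates e s‖), fun x => ⟨(hC _).1.trans (le_max_left _ _), ?_⟩⟩
  refine le_trans ?_ (le_max_right _ _)
  rw [norm_gradient, fderiv_comp x (hg.differentiable one_ne_zero _)
    (coordinates e s).differentiableAt, ContinuousLinearMap.fderiv]
  exact (ContinuousLinearMap.opNorm_comp_le _ _).trans
    (mul_le_mul_of_nonneg_right (hC _).2 (norm_nonneg _))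

/-- Dummy coordinates can be added, so two cylindrical functions can be written over the same index
set and subtracted. -/
theorem IsCylindricalC1b.exists_of_subset (h : IsCylindricalC1b e φ) :
    ∃ s : Finset ι, ∀ t, s ⊆ t → ∃ g : (t → ℝ) → ℝ, ContDiff ℝ 1 g ∧
      (∃ C : ℝ, ∀ y, |g y| ≤ C ∧ ‖fderiv ℝ g y‖ ≤ C) ∧ φ = g ∘ coordinates e t := by
  obtain ⟨s, g, hg, ⟨C, hC⟩, rfl⟩ := isCylindricalC1b_iff.1 h
  refine ⟨s, fun t hst => ?_⟩
  let R : (t → ℝ) →L[ℝ] (s → ℝ) :=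
    ContinuousLinearMap.pi fun i => ContinuousLinearMap.proj (⟨i, hst i.2⟩ : t)
  refine ⟨g ∘ R, hg.comp R.contDiff, ⟨max C (C * ‖R‖), fun y => ?_⟩, rfl⟩
  refine ⟨(hC _).1.trans (le_max_left _ _), le_trans ?_ (le_max_right _ _)⟩
  rw [fderiv_comp y (hg.differentiable one_ne_zero _) R.differentiableAt,
    ContinuousLinearMap.fderiv]
  exact (ContinuousLinearMap.opNorm_comp_le _ _).trans
    (mul_le_mul_of_nonneg_right (hC _).2 (norm_nonneg _))

theorem IsCylindricalC1b.sub (hφ : IsCylindricalC1b e φ) (hψ : IsCylindricalC1b e ψ) :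
    IsCylindricalC1b e fun x => φ x - ψ x := by
  classical
  obtain ⟨s, hs⟩ := hφ.exists_of_subset
  obtain ⟨t, ht⟩ := hψ.exists_of_subset
  obtain ⟨g, hg, ⟨C, hC⟩, rfl⟩ := hs (s ∪ t) Finset.subset_union_left
  obtain ⟨f, hf, ⟨D, hD⟩, rfl⟩ := ht (s ∪ t) Finset.subset_union_right
  refine ⟨s ∪ t, fun y => g y - f y, hg.sub hf, ⟨C + D, fun y => ⟨?_, ?_⟩⟩, fun x => rfl⟩
  · exact (abs_sub _ _).trans (add_le_add (hC y).1 (hD y).1)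
  · rw [fderiv_fun_sub (hg.differentiable one_ne_zero y) (hf.differentiable one_ne_zero y)]
    exact (norm_sub_le _ _).trans (add_le_add (hC y).2 (hD y).2)

end Cylindrical

/-! ### The graph of the closure of `Q^θ D` -/

section Closure

variable {X : Type*} [NormedAddCommGroup X] [InnerProductSpace ℝ X] [CompleteSpace X]
  [SecondCountableTopology X] [MeasurableSpace X] [BorelSpace X]
  {ι : Type*} {e : HilbertBasis ι ℝ X} {lam : ι → ℝ} {μ : Measure X} {p : ℝ≥0∞} {θ : ℝ}

theorem tendsto_eLpNorm_sub_trans {α E : Type*} [MeasurableSpace α] {ν : Measure α}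
    [NormedAddCommGroup E] {κ : Type*} {l : Filter κ} {f g : κ → α → E} {h : α → E}
    (hf : ∀ n, AEStronglyMeasurable (f n) ν) (hg : ∀ n, AEStronglyMeasurable (g n) ν)
    (hh : AEStronglyMeasurable h ν) (hp : 1 ≤ p)
    (h1 : Tendsto (fun n => eLpNorm (fun x => f n x - g n x) p ν) l (𝓝 0))
    (h2 : Tendsto (fun n => eLpNorm (fun x => g n x - h x) p ν) l (𝓝 0)) :
    Tendsto (fun n => eLpNorm (fun x => f n x - h x) p ν) l (𝓝 0) := by
  refine tendsto_of_tendsto_of_tendsto_of_le_of_le tendsto_const_nhds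
    (by simpa using h1.add h2) (fun _ => zero_le) fun n => ?_
  have e1 : (fun x => f n x - h x) = (fun x => f n x - g n x) + fun x => g n x - h x := by
    ext x; simp
  rw [e1]
  exact eLpNorm_add_le ((hf n).sub (hg n)) ((hg n).sub hh) hp

theorem IsCylindricalC1b.aestronglyMeasurable {φ : X → ℝ} (h : IsCylindricalC1b e φ) :
    AEStronglyMeasurable φ μ := h.contDiff.continuous.aestronglyMeasurable

theorem IsCylindricalC1b.aestronglyMeasurable_powQ {φ : X → ℝ} (h : IsCylindricalC1b e φ)
    (hlam : ∀ k, 0 < lam k) {B : ℝ} (hB : ∀ k, lam k ≤ B) (hθ : 0 ≤ θ) :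
    AEStronglyMeasurable (fun x => powQ e lam θ (gradient φ x)) μ := by
  obtain ⟨T, hT, -⟩ := exists_powQ_clm e hlam hB hθ
  simp only [hT]
  exact (T.continuous.comp (continuous_gradient h.contDiff)).aestronglyMeasurable

/-- The graph of the closure of `Q^θ D` is closed. -/
theorem HasSobolevGradient.of_tendsto (hlam : ∀ k, 0 < lam k) {B : ℝ} (hB : ∀ k, lam k ≤ B)
    (hθ : 0 ≤ θ) (hp : 1 ≤ p) {u : ℕ → X → ℝ} {G : ℕ → X → X} {v : X → ℝ} {H : X → X}
    (hu : ∀ n, HasSobolevGradient μ e lam θ p (u n) (G n)) (hv : MemLp v p μ) (hH : MemLp H p μ)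
    (huv : Tendsto (fun n => eLpNorm (fun x => u n x - v x) p μ) atTop (𝓝 0))
    (hGH : Tendsto (fun n => eLpNorm (fun x => G n x - H x) p μ) atTop (𝓝 0)) :
    HasSobolevGradient μ e lam θ p v H := by
  -- Diagonal choice: one cylindrical function close to the `n`-th pair in both components at once.
  have hex : ∀ n : ℕ, ∃ φ : X → ℝ, IsCylindricalC1b e φ ∧
      eLpNorm (fun x => φ x - u n x) p μ ≤ ((n : ℝ≥0∞) + 1)⁻¹ ∧
      eLpNorm (fun x => powQ e lam θ (gradient φ x) - G n x) p μ ≤ ((n : ℝ≥0∞) + 1)⁻¹ := by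
    intro n
    obtain ⟨-, -, φ, hφ, h1, h2⟩ := hu n
    have hpos : (0 : ℝ≥0∞) < ((n : ℝ≥0∞) + 1)⁻¹ := by
      rw [ENNReal.inv_pos]; exact ENNReal.add_ne_top.2 ⟨ENNReal.natCast_ne_top n, ENNReal.one_ne_top⟩
    obtain ⟨m, hm1, hm2⟩ := ((h1.eventually (gt_mem_nhds hpos)).and
      (h2.eventually (gt_mem_nhds hpos))).exists
    exact ⟨φ m, hφ m, hm1.le, hm2.le⟩
  choose φ hφ h1 h2 using hex
  have hlim : Tendsto (fun n : ℕ => ((n : ℝ≥0∞) + 1)⁻¹) atTop (𝓝 0) := by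
    have := (tendsto_add_atTop_iff_nat (f := fun n : ℕ => ((n : ℝ≥0∞))⁻¹) 1).2
      ENNReal.tendsto_inv_nat_nhds_zero
    simpa using this
  refine ⟨hv, hH, φ, hφ, ?_, ?_⟩
  · exact tendsto_eLpNorm_sub_trans (fun n => (hφ n).aestronglyMeasurable) (fun n => (hu n).1.1)
      hv.1 hp (tendsto_of_tendsto_of_tendsto_of_le_of_le tendsto_const_nhds hlim
        (fun _ => zero_le) h1) huv
  · exact tendsto_eLpNorm_sub_trans (fun n => (hφ n).aestronglyMeasurable_powQ hlam hB hθ)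
      (fun n => (hu n).2.1.1) hH.1 hp (tendsto_of_tendsto_of_tendsto_of_le_of_le
        tendsto_const_nhds hlim (fun _ => zero_le) h2) hGH

/-- The bounded operator `Q^θ` maps `L^p`-convergent gradients to `L^p`-convergent ones, so the same
approximating sequence serves for `θ`. -/
theorem HasSobolevGradient.powQ_of_zero (hlam : ∀ k, 0 < lam k) {B : ℝ} (hB : ∀ k, lam k ≤ B)
    (hθ : 0 ≤ θ) {u : X → ℝ} {G : X → X} (h : HasSobolevGradient μ e lam 0 p u G) :
    HasSobolevGradient μ e lam θ p u (fun x => powQ e lam θ (G x)) := by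
  obtain ⟨T, hT, -⟩ := exists_powQ_clm e hlam hB hθ
  obtain ⟨hu, hG, φ, hφ, h1, h2⟩ := h
  simp only [powQ_zero] at h2
  refine ⟨hu, ?_, φ, hφ, h1, ?_⟩
  · simp only [hT]
    exact T.comp_memLp' hG
  · simp only [hT, ← map_sub]
    have hlim : Tendsto (fun n => ‖T‖₊ • eLpNorm (fun x => gradient (φ n) x - G x) p μ) atTop
        (𝓝 0) := by
      have := ENNReal.Tendsto.const_mul (a := (‖T‖₊ : ℝ≥0∞)) h2 (Or.inr ENNReal.coe_ne_top)
      simpa [ENNReal.smul_def] using this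
    refine tendsto_of_tendsto_of_tendsto_of_le_of_le tendsto_const_nhds hlim
      (fun _ => zero_le) fun n => ?_
    exact eLpNorm_le_nnreal_smul_eLpNorm_of_ae_le_mul
      (Eventually.of_forall fun x => T.le_opNNNorm _) p

theorem HasSobolevGradient.sub (hlam : ∀ k, 0 < lam k) {B : ℝ} (hB : ∀ k, lam k ≤ B)
    (hθ : 0 ≤ θ) (hp : 1 ≤ p) {u v : X → ℝ} {G H : X → X}
    (hu : HasSobolevGradient μ e lam θ p u G) (hv : HasSobolevGradient μ e lam θ p v H) :
    HasSobolevGradient μ e lam θ p (fun x => u x - v x) (fun x => G x - H x) := by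
  obtain ⟨T, hT, -⟩ := exists_powQ_clm e hlam hB hθ
  obtain ⟨hu1, hG1, φ, hφ, h1, h2⟩ := hu
  obtain ⟨hv1, hH1, ψ, hψ, h3, h4⟩ := hv
  refine ⟨hu1.sub hv1, hG1.sub hH1, fun n x => φ n x - ψ n x, fun n => (hφ n).sub (hψ n), ?_, ?_⟩
  · refine tendsto_of_tendsto_of_tendsto_of_le_of_le tendsto_const_nhds
      (by simpa using h1.add h3) (fun _ => zero_le) fun n => ?_
    have e1 : (fun x => φ n x - ψ n x - (u x - v x))
        = (fun x => φ n x - u x) - fun x => ψ n x - v x := by ext x; simp; ring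
    simp only
    rw [e1]
    exact eLpNorm_sub_le ((hφ n).aestronglyMeasurable.sub hu1.1)
      ((hψ n).aestronglyMeasurable.sub hv1.1) hp
  · refine tendsto_of_tendsto_of_tendsto_of_le_of_le tendsto_const_nhds
      (by simpa using h2.add h4) (fun _ => zero_le) fun n => ?_
    have e1 : (fun x => powQ e lam θ (gradient (fun x => φ n x - ψ n x) x) - (G x - H x))
        = (fun x => powQ e lam θ (gradient (φ n) x) - G x)
          - fun x => powQ e lam θ (gradient (ψ n) x) - H x := by
      ext x
      simp only [Pi.sub_apply]
      rw [gradient_sub (hφ n).contDiff (hψ n).contDiff, hT, hT, hT, map_sub]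
      abel
    simp only
    rw [e1]
    exact eLpNorm_sub_le (((hφ n).aestronglyMeasurable_powQ hlam hB hθ).sub hG1.1)
      (((hψ n).aestronglyMeasurable_powQ hlam hB hθ).sub hH1.1) hp

end Closure

/-! ### Dominated convergence in `L^p` -/

section DominatedConvergence

/-- Dominated convergence in `L^p`. -/
theorem tendsto_eLpNorm_of_dominated {α E κ : Type*} [MeasurableSpace α] {ν : Measure α}
    [NormedAddCommGroup E] {l : Filter κ} [l.IsCountablyGenerated] {p : ℝ≥0∞} (hp0 : p ≠ 0)
    (hp : p ≠ ∞) {f : κ → α → E} {g : α → E} {b : α → ℝ}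
    (hf : ∀ᶠ n in l, AEStronglyMeasurable (f n) ν) (hg : AEStronglyMeasurable g ν)
    (hb : MemLp b p ν) (hle : ∀ᶠ n in l, ∀ᵐ x ∂ν, ‖f n x - g x‖ ≤ b x)
    (hlim : ∀ᵐ x ∂ν, Tendsto (fun n => f n x) l (𝓝 (g x))) :
    Tendsto (fun n => eLpNorm (fun x => f n x - g x) p ν) l (𝓝 0) := by
  simp only [eLpNorm_eq_lintegral_rpow_enorm_toReal hp0 hp]
  have hpos : 0 < p.toReal := ENNReal.toReal_pos hp0 hp
  have key : Tendsto (fun n => ∫⁻ x, ‖f n x - g x‖ₑ ^ p.toReal ∂ν) l (𝓝 (∫⁻ _, 0 ∂ν)) := by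
    refine tendsto_lintegral_filter_of_dominated_convergence' (fun x => ‖b x‖ₑ ^ p.toReal)
      ?_ ?_ ?_ ?_
    · filter_upwards [hf] with n hn using (hn.sub hg).enorm.pow_const _
    · filter_upwards [hle] with n hn
      filter_upwards [hn] with x hx
      refine ENNReal.rpow_le_rpow ?_ hpos.le
      exact enorm_le_iff_norm_le.2 (hx.trans (le_abs_self _))
    · exact (lintegral_rpow_enorm_lt_top_of_eLpNorm_lt_top hp0 hp hb.2).ne
    · filter_upwards [hlim] with x hx
      have h1 : Tendsto (fun n => ‖f n x - g x‖ₑ) l (𝓝 0) := by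
        simpa using (hx.sub_const (g x)).enorm
      have h2 := h1.ennrpow_const p.toReal
      rwa [ENNReal.zero_rpow_of_pos hpos] at h2
  have h := key.ennrpow_const (1 / p.toReal)
  rwa [lintegral_zero, ENNReal.zero_rpow_of_pos (by positivity)] at h

end DominatedConvergence

/-! ### Gaussian moments -/

section Moments

variable {X : Type*} [NormedAddCommGroup X] [InnerProductSpace ℝ X] [CompleteSpace X]
  [SecondCountableTopology X] [MeasurableSpace X] [BorelSpace X]

theorem memLp_one_add_norm (μ : Measure X) [IsGaussian μ] {p : ℝ≥0∞} (hp : p ≠ ∞) :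
    MemLp (fun x => 1 + ‖x‖) p μ := by
  have h1 : MemLp (fun _ : X => (1 : ℝ)) p μ := memLp_const 1
  have h2 : MemLp (fun x : X => ‖x‖) p μ := (IsGaussian.memLp_id μ p hp).norm
  exact h1.add h2

/-- The cube dominates the worst term in the approximation of functions of quadratic growth: `|u|
‖x‖`, produced by differentiating the cut-off. -/
theorem memLp_one_add_norm_pow (μ : Measure X) [IsGaussian μ] {p : ℝ≥0∞} (hp : p ≠ ∞) :
    MemLp (fun x => (1 + ‖x‖) ^ 3) p μ := by
  have h := (memLp_one_add_norm μ (p := p * 3) (ENNReal.mul_ne_top hp (by simp))).norm_rpow_div 3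
  rw [ENNReal.mul_div_cancel_right (by simp) (by simp)] at h
  refine h.congr_norm (by fun_prop) (Eventually.of_forall fun x => ?_)
  have : 0 ≤ 1 + ‖x‖ := by positivity
  simp only [ENNReal.toReal_ofNat, Real.norm_eq_abs, abs_of_nonneg this]
  rw [show (3 : ℝ) = ((3 : ℕ) : ℝ) by norm_num, Real.rpow_natCast]

end Moments

/-! ### Finite-dimensional projections -/

section Projection

variable {X : Type*} [NormedAddCommGroup X] [InnerProductSpace ℝ X] [CompleteSpace X]
  {ι : Type*}

/-- The vector with given coordinates in a finite set. -/
noncomputable def ofCoordinates (e : HilbertBasis ι ℝ X) (s : Finset ι) : (s → ℝ) →L[ℝ] X :=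
  ∑ i : s, (ContinuousLinearMap.proj i : (s → ℝ) →L[ℝ] ℝ).smulRight (e i)

theorem ofCoordinates_apply (e : HilbertBasis ι ℝ X) (s : Finset ι) (c : s → ℝ) :
    ofCoordinates e s c = ∑ i : s, c i • e i := by
  simp [ofCoordinates]

theorem inner_ofCoordinates (e : HilbertBasis ι ℝ X) (s : Finset ι) (c : s → ℝ) (i : s) :
    ⟪e i, ofCoordinates e s c⟫_ℝ = c i := by
  rw [ofCoordinates_apply]
  have h : Orthonormal ℝ (fun i : s => e i) := e.orthonormal.comp _ Subtype.val_injective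
  exact h.inner_right_fintype c i

theorem norm_le_norm_ofCoordinates (e : HilbertBasis ι ℝ X) (s : Finset ι) (c : s → ℝ) :
    ‖c‖ ≤ ‖ofCoordinates e s c‖ := by
  refine (pi_norm_le_iff_of_nonneg (norm_nonneg _)).2 fun i => ?_
  rw [← inner_ofCoordinates e s c i]
  refine (norm_inner_le_norm _ _).trans ?_
  rw [e.orthonormal.1, one_mul]

/-- The orthogonal projection onto the span of finitely many basis vectors. -/
noncomputable def coordProj (e : HilbertBasis ι ℝ X) (s : Finset ι) : X →L[ℝ] X :=
  ofCoordinates e s ∘L coordinates e s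

theorem coordProj_apply (e : HilbertBasis ι ℝ X) (s : Finset ι) (x : X) :
    coordProj e s x = ∑ i ∈ s, ⟪e i, x⟫_ℝ • e i := by
  rw [coordProj, ContinuousLinearMap.comp_apply, ofCoordinates_apply]
  exact Finset.sum_coe_sort s fun i => ⟪e i, x⟫_ℝ • e i

theorem inner_coordProj (e : HilbertBasis ι ℝ X) (s : Finset ι) (x y : X) :
    ⟪coordProj e s x, y⟫_ℝ = ⟪x, coordProj e s y⟫_ℝ := by
  simp only [coordProj_apply, sum_inner, inner_sum, real_inner_smul_left, real_inner_smul_right]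
  refine Finset.sum_congr rfl fun i _ => ?_
  rw [real_inner_comm x (e i)]
  ring

theorem coordProj_idem (e : HilbertBasis ι ℝ X) (s : Finset ι) (x : X) :
    coordProj e s (coordProj e s x) = coordProj e s x := by
  have : coordinates e s (coordProj e s x) = coordinates e s x := by
    ext i
    rw [coordinates_apply, coordProj, ContinuousLinearMap.comp_apply, inner_ofCoordinates]
  exact congrArg (ofCoordinates e s) this

theorem norm_coordProj_le (e : HilbertBasis ι ℝ X) (s : Finset ι) (x : X) :
    ‖coordProj e s x‖ ≤ ‖x‖ := by
  have h : ‖coordProj e s x‖ ^ 2 ≤ ‖x‖ * ‖coordProj e s x‖ := by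
    rw [← real_inner_self_eq_norm_sq, inner_coordProj, coordProj_idem]
    exact real_inner_le_norm _ _
  by_contra! hlt
  nlinarith [norm_nonneg x]

theorem exists_tendsto_coordProj [Countable ι] (e : HilbertBasis ι ℝ X) :
    ∃ s : ℕ → Finset ι, ∀ x, Tendsto (fun n => coordProj e (s n) x) atTop (𝓝 x) := by
  obtain ⟨s, hs⟩ := exists_seq_tendsto (atTop : Filter (Finset ι))
  refine ⟨s, fun x => ?_⟩
  have h := (e.hasSum_repr x).comp hs
  refine h.congr fun n => ?_
  simp [coordProj_apply, e.repr_apply_apply]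

/-- The projections are contractions, so their strong convergence tolerates a moving argument. -/
theorem tendsto_coordProj_of_tendsto {e : HilbertBasis ι ℝ X} {s : ℕ → Finset ι}
    (hs : ∀ x, Tendsto (fun n => coordProj e (s n) x) atTop (𝓝 x)) {v : ℕ → X} {x : X}
    (hv : Tendsto v atTop (𝓝 x)) : Tendsto (fun n => coordProj e (s n) (v n)) atTop (𝓝 x) := by
  have h1 : Tendsto (fun n => coordProj e (s n) (v n - x)) atTop (𝓝 0) := by
    refine squeeze_zero_norm (fun n => norm_coordProj_le e (s n) _) ?_
    simpa using (hv.sub_const x).norm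
  have h2 := h1.add (hs x)
  rw [zero_add] at h2
  refine h2.congr fun n => ?_
  rw [map_sub, sub_add_cancel]

end Projection

/-! ### Cylindrical approximation of `C¹` functions -/

section Smooth

variable {X : Type*} [NormedAddCommGroup X] [InnerProductSpace ℝ X] [CompleteSpace X]
  {ι : Type*} {u : X → ℝ} {g : X → X}

theorem contDiff_of_hasGradientAt (hu : ∀ x, HasGradientAt u (g x) x) (hg : Continuous g) :
    ContDiff ℝ 1 u := by
  refine contDiff_one_iff_fderiv.2 ⟨fun x => (hu x).differentiableAt, ?_⟩
  have : fderiv ℝ u = fun x => InnerProductSpace.toDual ℝ X (g x) :=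
    funext fun x => (hu x).hasFDerivAt.fderiv
  rw [this]
  exact (InnerProductSpace.toDual ℝ X).continuous.comp hg

/-- Cut-off of `u` by a function of the norm. -/
noncomputable def cutoff (η : ℝ → ℝ) (R : ℝ) (u : X → ℝ) (x : X) : ℝ :=
  u x * η (‖x‖ ^ 2 / R ^ 2)

theorem hasGradientAt_cutoff {η : ℝ → ℝ} (hη : ContDiff ℝ 1 η) (R : ℝ) {x : X}
    (hu : HasGradientAt u (g x) x) :
    HasGradientAt (cutoff η R u)
      (η (‖x‖ ^ 2 / R ^ 2) • g x + (u x * deriv η (‖x‖ ^ 2 / R ^ 2) * (2 / R ^ 2)) • x) x := by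
  rw [hasGradientAt_iff_hasFDerivAt]
  have h1 : HasFDerivAt (fun x : X => ‖x‖ ^ 2 / R ^ 2) ((R ^ 2)⁻¹ • (2 • innerSL ℝ x)) x := by
    simpa only [div_eq_inv_mul] using (hasStrictFDerivAt_norm_sq x).hasFDerivAt.const_mul (R ^ 2)⁻¹
  have h2 := ((hη.differentiable one_ne_zero _).hasDerivAt.comp_hasFDerivAt x h1)
  refine (hu.hasFDerivAt.mul h2).congr_fderiv ?_
  ext v
  simp [InnerProductSpace.toDual_apply_apply]
  ring

/-- Read in the finitely many coordinates, the cut-off function has compact support, so it and its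
derivative are bounded. -/
theorem isCylindricalC1b_cutoff (e : HilbertBasis ι ℝ X) (s : Finset ι) {η : ℝ → ℝ}
    (hη : ContDiff ℝ 1 η) (hsupp : ∀ t, 2 ≤ t → η t = 0) {R : ℝ} (hR : 0 < R)
    (hu : ContDiff ℝ 1 u) :
    IsCylindricalC1b e (fun x => cutoff η R u (coordProj e s x)) := by
  have hw : ContDiff ℝ 1 (cutoff η R u) := by
    unfold cutoff
    exact hu.mul (hη.comp ((contDiff_norm_sq ℝ).div_const _))
  set f : (s → ℝ) → ℝ := cutoff η R u ∘ ofCoordinates e s with hf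
  have hfc : ContDiff ℝ 1 f := hw.comp (ofCoordinates e s).contDiff
  have hcs : HasCompactSupport f := by
    refine HasCompactSupport.intro (isCompact_closedBall (0 : s → ℝ) (2 * R)) fun c hc => ?_
    rw [Metric.mem_closedBall, dist_zero_right, not_le] at hc
    have h1 := hc.trans_le (norm_le_norm_ofCoordinates e s c)
    have : 2 ≤ ‖ofCoordinates e s c‖ ^ 2 / R ^ 2 := by
      rw [le_div_iff₀ (by positivity)]
      nlinarith
    simp only [hf, Function.comp_apply, cutoff, hsupp _ this, mul_zero]
  obtain ⟨C, hC⟩ := hfc.continuous.bounded_above_of_compact_support hcs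
  obtain ⟨D, hD⟩ := (hfc.continuous_fderiv one_ne_zero).bounded_above_of_compact_support
    (hcs.fderiv ℝ)
  exact ⟨s, f, hfc, ⟨max C D, fun y => ⟨(hC y).trans (le_max_left _ _),
    (hD y).trans (le_max_right _ _)⟩⟩, fun x => rfl⟩

theorem hasGradientAt_comp_coordProj {w : X → ℝ} {e : HilbertBasis ι ℝ X} {s : Finset ι}
    {x v : X} (h : HasGradientAt w v (coordProj e s x)) :
    HasGradientAt (fun x => w (coordProj e s x)) (coordProj e s v) x := by
  rw [hasGradientAt_iff_hasFDerivAt] at h ⊢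
  refine (h.comp x (coordProj e s).hasFDerivAt).congr_fderiv ?_
  ext y
  simp [InnerProductSpace.toDual_apply_apply, inner_coordProj]

theorem exists_cutoff_function : ∃ η : ℝ → ℝ, ContDiff ℝ 1 η ∧ (∀ t, |η t| ≤ 1) ∧ η 0 = 1 ∧
    (∀ t, 2 ≤ t → η t = 0) ∧ ∃ D : ℝ, 0 ≤ D ∧ ∀ t, |deriv η t| ≤ D := by
  let η : ContDiffBump (0 : ℝ) := ⟨1, 2, one_pos, one_lt_two⟩
  have hη : ContDiff ℝ 1 η := η.contDiff
  obtain ⟨D, hD⟩ := (hη.continuous_deriv le_rfl).bounded_above_of_compact_support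
    η.hasCompactSupport.deriv
  refine ⟨η, hη, fun t => ?_, ?_, fun t ht => ?_, D, (norm_nonneg _).trans (hD 0), hD⟩
  · rw [abs_of_nonneg η.nonneg]; exact η.le_one
  · exact η.one_of_mem_closedBall (by simp [η])
  · exact η.zero_of_le_dist (by simpa [η] using ht.trans (le_abs_self t))

variable [SecondCountableTopology X] [MeasurableSpace X] [BorelSpace X]

/-- A `C¹` function whose gradient has linear growth belongs to `W^{1,p}`, and its Sobolev gradient
is the classical one. -/
theorem hasSobolevGradient_of_hasGradientAt [Countable ι] (e : HilbertBasis ι ℝ X) (lam : ι → ℝ)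
    (μ : Measure X) [IsGaussian μ] {p : ℝ≥0∞} (hp1 : 1 ≤ p) (hp : p ≠ ∞)
    (hu : ∀ x, HasGradientAt u (g x) x) (hg : Continuous g) {K : ℝ}
    (hKu : ∀ x, |u x| ≤ K * (1 + ‖x‖) ^ 2) (hKg : ∀ x, ‖g x‖ ≤ K * (1 + ‖x‖)) :
    HasSobolevGradient μ e lam 0 p u g := by
  have hp0 : p ≠ 0 := (zero_lt_one.trans_le hp1).ne'
  have hK : 0 ≤ K := by simpa using (norm_nonneg _).trans (hKg 0)
  have huc : ContDiff ℝ 1 u := contDiff_of_hasGradientAt hu hg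
  have hmem := memLp_one_add_norm_pow μ hp
  have h1n : ∀ x : X, 1 ≤ 1 + ‖x‖ := fun x => by linarith [norm_nonneg x]
  have hpow2 : ∀ x : X, (1 + ‖x‖) ^ 2 ≤ (1 + ‖x‖) ^ 3 := fun x =>
    pow_le_pow_right₀ (h1n x) (by norm_num)
  have hpow1 : ∀ x : X, 1 + ‖x‖ ≤ (1 + ‖x‖) ^ 3 := fun x => le_self_pow₀ (h1n x) (by norm_num)
  have hu3 : ∀ x, ‖u x‖ ≤ K * (1 + ‖x‖) ^ 3 := fun x =>
    (hKu x).trans (mul_le_mul_of_nonneg_left (hpow2 x) hK)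
  have hg3 : ∀ x, ‖g x‖ ≤ K * (1 + ‖x‖) ^ 3 := fun x =>
    (hKg x).trans (mul_le_mul_of_nonneg_left (hpow1 x) hK)
  obtain ⟨η, hη, hη1, hη0, hηs, D, hD0, hD⟩ := exists_cutoff_function
  obtain ⟨s, hs⟩ := exists_tendsto_coordProj e
  -- The approximants are cut off at radius `n + 1`, nonzero already for `n = 0`, and composed with
  -- the `n`-th projection. That projection is self-adjoint and so reappears outside the gradient.
  have hgrad : ∀ (n : ℕ) x, gradient (fun x => cutoff η ((n : ℝ) + 1) u (coordProj e (s n) x)) x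
      = coordProj e (s n) (η (‖coordProj e (s n) x‖ ^ 2 / ((n : ℝ) + 1) ^ 2) •
        g (coordProj e (s n) x) + (u (coordProj e (s n) x) *
          deriv η (‖coordProj e (s n) x‖ ^ 2 / ((n : ℝ) + 1) ^ 2) * (2 / ((n : ℝ) + 1) ^ 2)) •
            coordProj e (s n) x) := fun n x =>
    (hasGradientAt_comp_coordProj (hasGradientAt_cutoff hη _ (hu _))).gradient
  have hcyl : ∀ n : ℕ, IsCylindricalC1b e
      (fun x => cutoff η ((n : ℝ) + 1) u (coordProj e (s n) x)) := fun n =>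
    isCylindricalC1b_cutoff e (s n) hη hηs (by positivity) huc
  have hsq : Tendsto (fun n : ℕ => (2 : ℝ) / ((n : ℝ) + 1) ^ 2) atTop (𝓝 0) := by
    have h := ((tendsto_one_div_add_atTop_nhds_zero_nat (𝕜 := ℝ)).pow 2).const_mul 2
    simp only [ne_eq, OfNat.ofNat_ne_zero, not_false_eq_true, zero_pow, mul_zero] at h
    refine h.congr fun n => ?_
    field_simp
  have harg : ∀ x, Tendsto (fun n : ℕ => ‖coordProj e (s n) x‖ ^ 2 / ((n : ℝ) + 1) ^ 2) atTop
      (𝓝 0) := by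
    intro x
    have h := (((hs x).norm.pow 2).div_const 2).mul hsq
    rw [mul_zero] at h
    refine h.congr fun n => ?_
    field_simp
  have hηlim : ∀ x, Tendsto (fun n : ℕ => η (‖coordProj e (s n) x‖ ^ 2 / ((n : ℝ) + 1) ^ 2)) atTop
      (𝓝 1) := by
    intro x
    have h := (hη.continuous.tendsto 0).comp (harg x)
    rwa [hη0] at h
  have hη'lim : ∀ x, Tendsto (fun n : ℕ =>
      deriv η (‖coordProj e (s n) x‖ ^ 2 / ((n : ℝ) + 1) ^ 2)) atTop (𝓝 (deriv η 0)) :=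
    fun x => ((hη.continuous_deriv le_rfl).tendsto 0).comp (harg x)
  have hulim : ∀ x, Tendsto (fun n => u (coordProj e (s n) x)) atTop (𝓝 (u x)) :=
    fun x => (huc.continuous.tendsto x).comp (hs x)
  have hglim : ∀ x, Tendsto (fun n => g (coordProj e (s n) x)) atTop (𝓝 (g x)) :=
    fun x => (hg.tendsto x).comp (hs x)
  have hPn : ∀ (n : ℕ) (x : X), (1 + ‖coordProj e (s n) x‖) ≤ 1 + ‖x‖ := fun n x => by
    linarith [norm_coordProj_le e (s n) x]
  refine ⟨(hmem.const_mul K).of_le huc.continuous.aestronglyMeasurable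
      (Eventually.of_forall fun x => (hu3 x).trans (le_abs_self _)),
    (hmem.const_mul K).of_le hg.aestronglyMeasurable
      (Eventually.of_forall fun x => (hg3 x).trans (le_abs_self _)), _, hcyl, ?_, ?_⟩
  · refine tendsto_eLpNorm_of_dominated hp0 hp (b := fun x => 2 * K * (1 + ‖x‖) ^ 3)
      (Eventually.of_forall fun n => (hcyl n).aestronglyMeasurable)
      huc.continuous.aestronglyMeasurable (hmem.const_mul (2 * K))
      (Eventually.of_forall fun n => Eventually.of_forall fun x => ?_)
      (Eventually.of_forall fun x => ?_)
    · have h1 : ‖cutoff η ((n : ℝ) + 1) u (coordProj e (s n) x)‖ ≤ K * (1 + ‖x‖) ^ 3 := by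
        rw [cutoff, norm_mul]
        calc _ ≤ (K * (1 + ‖coordProj e (s n) x‖) ^ 3) * 1 :=
              mul_le_mul (hu3 _) (hη1 _) (abs_nonneg _) (by positivity)
          _ ≤ K * (1 + ‖x‖) ^ 3 := by
              rw [mul_one]
              gcongr
              exact norm_coordProj_le e (s n) x
      linarith [norm_sub_le (cutoff η ((n : ℝ) + 1) u (coordProj e (s n) x)) (u x), hu3 x]
    · simpa [cutoff] using (hulim x).mul (hηlim x)
  · simp only [powQ_zero]
    -- One `K` comes from `g` and one from the cut-off copy of `g`; `2 K D` comes from the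
    -- derivative of the cut-off, with `|u| ≤ K (1 + ‖x‖)²`, `|η'| ≤ D` and `2 / (n + 1)² ≤ 2`.
    refine tendsto_eLpNorm_of_dominated hp0 hp (b := fun x => (2 * K + 2 * K * D) * (1 + ‖x‖) ^ 3)
      (Eventually.of_forall fun n => (continuous_gradient (hcyl n).contDiff).aestronglyMeasurable)
      hg.aestronglyMeasurable (hmem.const_mul (2 * K + 2 * K * D))
      (Eventually.of_forall fun n => Eventually.of_forall fun x => ?_)
      (Eventually.of_forall fun x => ?_)
    · rw [hgrad]
      set y := coordProj e (s n) x
      have hy : ‖y‖ ≤ ‖x‖ := norm_coordProj_le e (s n) x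
      have h1 : ‖η (‖y‖ ^ 2 / ((n : ℝ) + 1) ^ 2) • g y‖ ≤ K * (1 + ‖x‖) ^ 3 := by
        rw [norm_smul]
        calc _ ≤ 1 * (K * (1 + ‖y‖) ^ 3) :=
              mul_le_mul (hη1 _) (hg3 _) (norm_nonneg _) zero_le_one
          _ ≤ K * (1 + ‖x‖) ^ 3 := by
              rw [one_mul]
              gcongr
      have h2 : ‖(u y * deriv η (‖y‖ ^ 2 / ((n : ℝ) + 1) ^ 2) * (2 / ((n : ℝ) + 1) ^ 2)) • y‖
          ≤ 2 * K * D * (1 + ‖x‖) ^ 3 := by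
        rw [norm_smul, norm_mul, norm_mul]
        have h3 : ‖2 / ((n : ℝ) + 1) ^ 2‖ ≤ 2 := by
          rw [Real.norm_of_nonneg (by positivity)]
          refine div_le_self zero_le_two (one_le_pow₀ ?_)
          linarith [(Nat.cast_nonneg n : (0 : ℝ) ≤ n)]
        calc _ ≤ K * (1 + ‖x‖) ^ 2 * D * 2 * (1 + ‖x‖) := by
              gcongr
              · refine (hKu y).trans ?_
                gcongr
              · exact hD _
              · linarith
          _ = _ := by ring
      have h4 := norm_coordProj_le e (s n) (η (‖y‖ ^ 2 / ((n : ℝ) + 1) ^ 2) • g y +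
        (u y * deriv η (‖y‖ ^ 2 / ((n : ℝ) + 1) ^ 2) * (2 / ((n : ℝ) + 1) ^ 2)) • y)
      refine (norm_sub_le _ _).trans ?_
      have h5 := (h4.trans (norm_add_le _ _)).trans (add_le_add h1 h2)
      linarith [hg3 x]
    · simp only [hgrad]
      refine tendsto_coordProj_of_tendsto hs ?_
      have h := ((hηlim x).smul (hglim x)).add
        ((((hulim x).mul (hη'lim x)).mul hsq).smul (hs x))
      simpa using h

end Smooth

/-! ### Gaussian integration by parts on the line -/

section OneDimensional

/-- Integration by parts for a centred Gaussian measure on the real line. -/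
theorem integral_deriv_gaussianReal {v : NNReal} (hv : v ≠ 0) {f f' : ℝ → ℝ}
    (hf : ∀ t, HasDerivAt f (f' t) t) (hf' : Continuous f') {C : ℝ} (hC : ∀ t, |f t| ≤ C)
    (hC' : ∀ t, |f' t| ≤ C) :
    (v : ℝ) * ∫ t, f' t ∂(gaussianReal 0 v) = ∫ t, t * f t ∂(gaussianReal 0 v) := by
  have hv0 : (0 : ℝ) < v := by positivity
  have hfc : Continuous f := continuous_iff_continuousAt.2 fun t => (hf t).continuousAt
  have hpdf : ∀ t, HasDerivAt (gaussianPDFReal 0 v) (-(t / v) * gaussianPDFReal 0 v t) t := by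
    intro t
    rw [gaussianPDFReal_def]
    have h1 : HasDerivAt (fun x : ℝ => -(x - 0) ^ 2 / (2 * (v : ℝ))) (-(t / v)) t := by
      have := (((hasDerivAt_id t).sub_const 0).pow 2).neg.div_const (2 * (v : ℝ))
      refine this.congr_deriv ?_
      simp only [id]
      field_simp
      ring
    refine (h1.exp.const_mul _).congr_deriv ?_
    ring
  have hint : Integrable (gaussianPDFReal 0 v) := integrable_gaussianPDFReal 0 v
  have hint' : Integrable (fun t => -(t / v) * gaussianPDFReal 0 v t) := by
    have h := (integrable_mul_exp_neg_mul_sq (b := 1 / (2 * (v : ℝ))) (by positivity)).const_mul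
      (-(1 / v) * (√(2 * Real.pi * v))⁻¹)
    refine h.congr (Eventually.of_forall fun t => ?_)
    simp only [gaussianPDFReal_def]
    rw [show -(t - 0) ^ 2 / (2 * (v : ℝ)) = -(1 / (2 * (v : ℝ))) * t ^ 2 by ring]
    ring
  have h := integral_mul_deriv_eq_deriv_mul_of_integrable (u := f) (u' := f')
    (v := gaussianPDFReal 0 v) (v' := fun t => -(t / v) * gaussianPDFReal 0 v t)
    (fun t _ => hf t) (fun t _ => hpdf t)
    (hint'.bdd_mul hfc.aestronglyMeasurable (Eventually.of_forall hC))
    (hint.bdd_mul hf'.aestronglyMeasurable (Eventually.of_forall hC'))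
    (hint.bdd_mul hfc.aestronglyMeasurable (Eventually.of_forall hC))
  rw [integral_gaussianReal_eq_integral_smul hv, integral_gaussianReal_eq_integral_smul hv]
  simp only [smul_eq_mul]
  have e1 : ∫ t, gaussianPDFReal 0 v t * f' t = ∫ t, f' t * gaussianPDFReal 0 v t := by
    simp only [mul_comm]
  rw [e1, ← neg_eq_iff_eq_neg.2 h, ← integral_neg, ← integral_const_mul]
  refine integral_congr_ae (Eventually.of_forall fun t => ?_)
  simp only
  field_simp

end OneDimensional

/-! ### Integration by parts and Fourier uniqueness for `μ` -/

section Gaussian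

variable {X : Type*} [NormedAddCommGroup X] [InnerProductSpace ℝ X] [CompleteSpace X]
  [SecondCountableTopology X] [MeasurableSpace X] [BorelSpace X]
  {μ : Measure X} [IsGaussian μ]

theorem integral_inner_eq_zero (hmean : ∫ x, x ∂μ = 0) (a : X) : ∫ x, ⟪a, x⟫_ℝ ∂μ = 0 := by
  have h := IsGaussian.integral_dual (μ := μ) (innerSL ℝ a)
  rw [hmean, map_zero] at h
  exact h

theorem covariance_inner (hmean : ∫ x, x ∂μ = 0) (a b : X) :
    cov[fun x => ⟪a, x⟫_ℝ, fun x => ⟪b, x⟫_ℝ; μ] = ⟪covarianceOperator μ a, b⟫_ℝ := by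
  rw [covarianceOperator_inner IsGaussian.memLp_two_id, covariance, integral_inner_eq_zero hmean,
    integral_inner_eq_zero hmean]
  simp

/-- The component of a centred Gaussian along an eigenvector of the covariance is independent of
the orthogonal component. -/
theorem indepFun_inner_sub (hmean : ∫ x, x ∂μ = 0) {h : X} {l : ℝ} (hh : ‖h‖ = 1)
    (hQ : covarianceOperator μ h = l • h) :
    IndepFun (fun x => ⟪h, x⟫_ℝ) (fun x => x - ⟪h, x⟫_ℝ • h) μ := by
  let L : X →L[ℝ] ℝ × X := (innerSL ℝ h).prod
    (ContinuousLinearMap.id ℝ X - (innerSL ℝ h).smulRight h)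
  have hg : HasGaussianLaw (fun x => (⟪h, x⟫_ℝ, x - ⟪h, x⟫_ℝ • h)) μ :=
    (IsGaussian.hasGaussianLaw_id (μ := μ)).map L
  refine hg.indepFun_of_covariance_inner fun a y => ?_
  have e1 : (fun x => ⟪a, ⟪h, x⟫_ℝ⟫_ℝ) = fun x => ⟪a • h, x⟫_ℝ := by
    ext x
    rw [real_inner_smul_left]
    simp [mul_comm]
  have e2 : (fun x => ⟪y, x - ⟪h, x⟫_ℝ • h⟫_ℝ) = fun x => ⟪y - ⟪y, h⟫_ℝ • h, x⟫_ℝ := by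
    ext x
    rw [inner_sub_right, real_inner_smul_right, inner_sub_left, real_inner_smul_left]
    ring
  rw [e1, e2, covariance_inner hmean, map_smul, hQ, real_inner_smul_left, real_inner_smul_left,
    inner_sub_right, real_inner_smul_right, real_inner_self_eq_norm_sq, hh, real_inner_comm y h]
  ring

theorem map_inner_eq_gaussianReal (hmean : ∫ x, x ∂μ = 0) {h : X} {l : ℝ} (hh : ‖h‖ = 1)
    (hQ : covarianceOperator μ h = l • h) :
    μ.map (fun x => ⟪h, x⟫_ℝ) = gaussianReal 0 l.toNNReal := by
  have hg : HasGaussianLaw (fun x => ⟪h, x⟫_ℝ) μ :=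
    (IsGaussian.hasGaussianLaw_id (μ := μ)).map (innerSL ℝ h)
  rw [hg.map_eq_gaussianReal, integral_inner_eq_zero hmean, ← covariance_self hg.aemeasurable,
    covariance_inner hmean, hQ, real_inner_smul_left, real_inner_self_eq_norm_sq, hh]
  simp

/-- Integration by parts along an eigenvector of the covariance. -/
theorem integral_directional_deriv (hmean : ∫ x, x ∂μ = 0) {h : X} {l : ℝ} (hl : 0 < l)
    (hh : ‖h‖ = 1) (hQ : covarianceOperator μ h = l • h) {F F' : X → ℝ} (hF : Continuous F)
    (hF' : Continuous F') (hd : ∀ x, HasDerivAt (fun t : ℝ => F (x + t • h)) (F' x) 0)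
    {C : ℝ} (hC : ∀ x, |F x| ≤ C) (hC' : ∀ x, |F' x| ≤ C) :
    l * ∫ x, F' x ∂μ = ∫ x, ⟪h, x⟫_ℝ * F x ∂μ := by
  set γ := gaussianReal 0 l.toNNReal with hγ
  set ρ := μ.map (fun x => x - ⟪h, x⟫_ℝ • h) with hρ
  have hm1 : Measurable (fun x : X => ⟪h, x⟫_ℝ) := by fun_prop
  have hm2 : Measurable (fun x : X => x - ⟪h, x⟫_ℝ • h) := by fun_prop
  have : IsProbabilityMeasure ρ := Measure.isProbabilityMeasure_map hm2.aemeasurable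
  -- By independence the joint law is a product, so Fubini reduces the claim to the line in
  -- direction `h` with the orthogonal part frozen.
  have hmap : μ.map (fun x => (⟪h, x⟫_ℝ, x - ⟪h, x⟫_ℝ • h)) = γ.prod ρ := by
    rw [(indepFun_inner_sub hmean hh hQ).map_prod_eq_prod_map_map hm1.aemeasurable
      hm2.aemeasurable, map_inner_eq_gaussianReal hmean hh hQ]
  have hint : ∀ {Φ : ℝ × X → ℝ}, Continuous Φ →
      ∫ x, Φ (⟪h, x⟫_ℝ, x - ⟪h, x⟫_ℝ • h) ∂μ = ∫ z, Φ z ∂(γ.prod ρ) := by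
    intro Φ hΦ
    rw [← hmap, integral_map (hm1.prodMk hm2).aemeasurable hΦ.aestronglyMeasurable]
  -- The derivative is given only at parameter `0`; moving the base point along the line gives it at
  -- every `t`.
  have hline : ∀ r t, HasDerivAt (fun t : ℝ => F (r + t • h)) (F' (r + t • h)) t := by
    intro r t
    have h1 := hd (r + t • h)
    have h2 : HasDerivAt (fun s : ℝ => s - t) 1 t := (hasDerivAt_id t).sub_const t
    have h3 := HasDerivAt.comp t (h₂ := fun s : ℝ => F (r + t • h + s • h)) (h := fun s => s - t)
      (by rw [sub_self]; exact h1) h2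
    rw [mul_one] at h3
    refine h3.congr_of_eventuallyEq (Eventually.of_forall fun s => ?_)
    simp only [Function.comp_apply]
    congr 1
    module
  have hone : ∀ r, l * ∫ t, F' (r + t • h) ∂γ = ∫ t, t * F (r + t • h) ∂γ := by
    intro r
    have h1 := integral_deriv_gaussianReal (v := l.toNNReal) (by simpa using hl) (hline r)
      (by fun_prop) (fun t => hC _) (fun t => hC' _)
    rwa [Real.coe_toNNReal l hl.le] at h1
  have e1 : ∫ x, F' x ∂μ = ∫ z : ℝ × X, F' (z.2 + z.1 • h) ∂(γ.prod ρ) := by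
    rw [← hint (Φ := fun z => F' (z.2 + z.1 • h)) (by fun_prop)]
    simp
  have e2 : ∫ x, ⟪h, x⟫_ℝ * F x ∂μ = ∫ z : ℝ × X, z.1 * F (z.2 + z.1 • h) ∂(γ.prod ρ) := by
    rw [← hint (Φ := fun z => z.1 * F (z.2 + z.1 • h)) (by fun_prop)]
    simp
  have i1 : Integrable (fun z : ℝ × X => F' (z.2 + z.1 • h)) (γ.prod ρ) :=
    Integrable.of_bound (Continuous.aestronglyMeasurable (by fun_prop)) C
      (Eventually.of_forall fun z => hC' _)
  have i2 : Integrable (fun z : ℝ × X => z.1 * F (z.2 + z.1 • h)) (γ.prod ρ) := by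
    have hid : Integrable (fun t : ℝ => t) γ := by
      simpa using! (memLp_id_gaussianReal (μ := 0) (v := l.toNNReal) 1).integrable le_rfl
    refine (hid.comp_fst ρ).mul_bdd (c := C) (Continuous.aestronglyMeasurable (by fun_prop))
      (Eventually.of_forall fun z => hC _)
  rw [e1, e2, integral_prod_symm _ i1, integral_prod_symm _ i2, ← integral_const_mul]
  exact integral_congr_ae (Eventually.of_forall hone)

/-- An integrable function all of whose Fourier coefficients vanish is zero. -/
theorem ae_eq_zero_of_integral_cos_sin {H : X → ℝ} (hH : Integrable H μ)
    (hcos : ∀ y, ∫ x, H x * Real.cos ⟪y, x⟫_ℝ ∂μ = 0)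
    (hsin : ∀ y, ∫ x, H x * Real.sin ⟪y, x⟫_ℝ ∂μ = 0) : H =ᵐ[μ] 0 := by
  have hm1 : AEMeasurable (fun x => ENNReal.ofReal (H x)) μ := hH.1.aemeasurable.ennreal_ofReal
  have hm2 : AEMeasurable (fun x => ENNReal.ofReal (-H x)) μ :=
    hH.1.aemeasurable.neg.ennreal_ofReal
  have hf1 : ∫⁻ x, ENNReal.ofReal (H x) ∂μ ≠ ∞ := hH.lintegral_lt_top.ne
  have hf2 : ∫⁻ x, ENNReal.ofReal (-H x) ∂μ ≠ ∞ := hH.neg.lintegral_lt_top.ne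
  have := isFiniteMeasure_withDensity hf1
  have := isFiniteMeasure_withDensity hf2
  -- `H⁺ μ` and `H⁻ μ` are finite measures, and the vanishing coefficients say that their
  -- characteristic functions agree.
  have key : μ.withDensity (fun x => ENNReal.ofReal (H x))
      = μ.withDensity (fun x => ENNReal.ofReal (-H x)) := by
    refine Measure.ext_of_charFun (funext fun y => ?_)
    rw [charFun_apply, charFun_apply,
      integral_withDensity_eq_integral_toReal_smul₀ hm1 (Eventually.of_forall fun _ =>
        ENNReal.ofReal_lt_top),
      integral_withDensity_eq_integral_toReal_smul₀ hm2 (Eventually.of_forall fun _ =>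
        ENNReal.ofReal_lt_top), ← sub_eq_zero]
    have hb : ∀ x : X, ‖Complex.exp (⟪x, y⟫_ℝ * Complex.I)‖ ≤ 1 := fun x =>
      (Complex.norm_exp_ofReal_mul_I _).le
    have hc : AEStronglyMeasurable (fun x : X => Complex.exp (⟪x, y⟫_ℝ * Complex.I)) μ :=
      Continuous.aestronglyMeasurable (by fun_prop)
    have hi : ∀ {f : X → ℝ}, Integrable f μ →
        Integrable (fun x => (ENNReal.ofReal (f x)).toReal • Complex.exp (⟪x, y⟫_ℝ * Complex.I))
          μ := by
      intro f hf
      have h1 : Integrable (fun x => (ENNReal.ofReal (f x)).toReal) μ := by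
        simpa only [ENNReal.toReal_ofReal'] using hf.pos_part
      exact (h1.ofReal (𝕜 := ℂ)).mul_bdd hc (Eventually.of_forall hb) |>.congr
        (Eventually.of_forall fun x => (Complex.real_smul).symm)
    rw [← integral_sub (hi hH) (hi (f := fun x => -H x) hH.neg)]
    have e : ∀ x, (ENNReal.ofReal (H x)).toReal • Complex.exp (⟪x, y⟫_ℝ * Complex.I)
        - (ENNReal.ofReal (-H x)).toReal • Complex.exp (⟪x, y⟫_ℝ * Complex.I)
        = ((H x * Real.cos ⟪y, x⟫_ℝ : ℝ) : ℂ) + ((H x * Real.sin ⟪y, x⟫_ℝ : ℝ) : ℂ) * Complex.I := by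
      intro x
      rw [← sub_smul, ENNReal.toReal_ofReal', ENNReal.toReal_ofReal', max_zero_sub_eq_self,
        Complex.exp_mul_I, Complex.real_smul, real_inner_comm y x]
      push_cast
      ring
    have ic : Integrable (fun x => H x * Real.cos ⟪y, x⟫_ℝ) μ :=
      hH.mul_bdd (c := 1) (Continuous.aestronglyMeasurable (by fun_prop))
        (Eventually.of_forall fun x => Real.abs_cos_le_one _)
    have is : Integrable (fun x => H x * Real.sin ⟪y, x⟫_ℝ) μ :=
      hH.mul_bdd (c := 1) (Continuous.aestronglyMeasurable (by fun_prop))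
        (Eventually.of_forall fun x => Real.abs_sin_le_one _)
    calc _ = ∫ x, (((H x * Real.cos ⟪y, x⟫_ℝ : ℝ) : ℂ)
          + ((H x * Real.sin ⟪y, x⟫_ℝ : ℝ) : ℂ) * Complex.I) ∂μ :=
          integral_congr_ae (Eventually.of_forall e)
      _ = 0 := by
          rw [integral_add ic.ofReal (is.ofReal.mul_const _), integral_mul_const,
            integral_complex_ofReal, integral_complex_ofReal, hcos, hsin]
          simp
  have h := (withDensity_eq_iff hm1 hm2 hf1).1 key
  filter_upwards [h] with x hx
  by_contra hne
  rcases lt_or_gt_of_ne hne with hlt | hlt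
  · simp only [Pi.zero_apply] at hlt
    rw [ENNReal.ofReal_of_nonpos hlt.le, eq_comm, ENNReal.ofReal_eq_zero] at hx
    linarith
  · simp only [Pi.zero_apply] at hlt
    rw [ENNReal.ofReal_of_nonpos (by linarith : -H x ≤ 0), ENNReal.ofReal_eq_zero] at hx
    linarith

end Gaussian

/-! ### Closability of `Q^θ D` -/

section Uniqueness

theorem tendsto_integral_mul_of_eLpNorm {α : Type*} [MeasurableSpace α] {ν : Measure α}
    [IsProbabilityMeasure ν] {p : ℝ≥0∞} (hp : 1 ≤ p) {f : ℕ → α → ℝ} {g b : α → ℝ}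
    (hf : ∀ n, Integrable (f n) ν) (hg : Integrable g ν)
    (hfg : Tendsto (fun n => eLpNorm (fun x => f n x - g x) p ν) atTop (𝓝 0))
    (hb : AEStronglyMeasurable b ν) {C : ℝ} (hC : ∀ x, |b x| ≤ C) :
    Tendsto (fun n => ∫ x, f n x * b x ∂ν) atTop (𝓝 (∫ x, g x * b x ∂ν)) := by
  refine tendsto_integral_of_L1' _ (hg.mul_bdd hb (Eventually.of_forall hC)).1
    (Eventually.of_forall fun n => (hf n).mul_bdd hb (Eventually.of_forall hC)) ?_
  have hlim : Tendsto (fun n => ENNReal.ofReal C * eLpNorm (fun x => f n x - g x) p ν) atTop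
      (𝓝 0) := by
    simpa using ENNReal.Tendsto.const_mul hfg (Or.inr (ENNReal.ofReal_ne_top (r := C)))
  refine tendsto_of_tendsto_of_tendsto_of_le_of_le tendsto_const_nhds hlim
    (fun _ => zero_le) fun n => ?_
  calc eLpNorm ((fun x => f n x * b x) - fun x => g x * b x) 1 ν
      ≤ ENNReal.ofReal C * eLpNorm (fun x => f n x - g x) 1 ν := by
        refine eLpNorm_le_mul_eLpNorm_of_ae_le_mul (Eventually.of_forall fun x => ?_) 1
        simp only [Pi.sub_apply]
        rw [← sub_mul, norm_mul, mul_comm]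
        exact mul_le_mul_of_nonneg_right (hC x) (norm_nonneg _)
    _ ≤ _ := by
        gcongr
        exact eLpNorm_le_eLpNorm_of_exponent_le hp ((hf n).1.sub hg.1)

variable {X : Type*} [NormedAddCommGroup X] [InnerProductSpace ℝ X]

/-- A bounded function with bounded derivative in the direction `h`, such that its product with
`⟪h, x⟫` is bounded as well. -/
structure IsTestFunction (h : X) (ψ ψ' : X → ℝ) : Prop where
  continuous : Continuous ψ
  continuous_deriv : Continuous ψ'
  hasDerivAt : ∀ x, HasDerivAt (fun t : ℝ => ψ (x + t • h)) (ψ' x) 0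
  bounded : ∃ C : ℝ, ∀ x, |ψ x| ≤ C ∧ |ψ' x| ≤ C ∧ |⟪h, x⟫_ℝ * ψ x| ≤ C

/-- Trigonometric functions alone fail because integration by parts produces the unbounded factor
`⟪h, x⟫`. The weight `(1 + ⟪h, x⟫²)⁻¹` absorbs it, and its positivity lets it be removed at the end.
-/
theorem isTestFunction_trig {h : X} (hh : ‖h‖ = 1) (y : X) {τ τ' : ℝ → ℝ}
    (hτ : ∀ t, HasDerivAt τ (τ' t) t) (hτc' : Continuous τ') (hb : ∀ t, |τ t| ≤ 1)
    (hb' : ∀ t, |τ' t| ≤ 1) :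
    IsTestFunction h (fun x => (1 + ⟪h, x⟫_ℝ ^ 2)⁻¹ * τ ⟪y, x⟫_ℝ)
      (fun x => -(2 * ⟪h, x⟫_ℝ) / (1 + ⟪h, x⟫_ℝ ^ 2) ^ 2 * τ ⟪y, x⟫_ℝ
        + (1 + ⟪h, x⟫_ℝ ^ 2)⁻¹ * (τ' ⟪y, x⟫_ℝ * ⟪y, h⟫_ℝ)) := by
  have hτc : Continuous τ := continuous_iff_continuousAt.2 fun t => (hτ t).continuousAt
  have hpos : ∀ s : ℝ, 0 < 1 + s ^ 2 := fun s => by positivity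
  have b1 : ∀ s : ℝ, |(1 + s ^ 2)⁻¹| ≤ 1 := fun s => by
    rw [abs_of_pos (inv_pos.2 (hpos s))]
    exact inv_le_one_of_one_le₀ (by nlinarith [sq_nonneg s])
  have b2 : ∀ s : ℝ, |s * (1 + s ^ 2)⁻¹| ≤ 1 := fun s => by
    rw [abs_mul, abs_of_pos (inv_pos.2 (hpos s)), ← div_eq_mul_inv, div_le_one (hpos s)]
    nlinarith [sq_abs s, sq_nonneg (|s| - 1)]
  have b3 : ∀ s : ℝ, |-(2 * s) / (1 + s ^ 2) ^ 2| ≤ 2 := fun s => by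
    have : -(2 * s) / (1 + s ^ 2) ^ 2 = -2 * (s * (1 + s ^ 2)⁻¹) * (1 + s ^ 2)⁻¹ := by
      field_simp
    rw [this, abs_mul, abs_mul]
    have h1 := b1 s
    have h2 := b2 s
    rw [show |(-2 : ℝ)| = 2 by norm_num]
    nlinarith [abs_nonneg (s * (1 + s ^ 2)⁻¹), abs_nonneg ((1 + s ^ 2)⁻¹)]
  refine ⟨?_, ?_, fun x => ?_, 2 + |⟪y, h⟫_ℝ|, fun x => ⟨?_, ?_, ?_⟩⟩
  · exact ((by fun_prop : Continuous fun x : X => 1 + ⟪h, x⟫_ℝ ^ 2).inv₀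
      fun x => (hpos _).ne').mul (by fun_prop)
  · refine Continuous.add (Continuous.mul (Continuous.div (by fun_prop) (by fun_prop)
      fun x => (pow_pos (hpos _) 2).ne') (by fun_prop)) (Continuous.mul ?_ (by fun_prop))
    exact (by fun_prop : Continuous fun x : X => 1 + ⟪h, x⟫_ℝ ^ 2).inv₀ fun x => (hpos _).ne'
  · have h1 : HasDerivAt (fun t : ℝ => ⟪h, x⟫_ℝ + t) 1 0 := (hasDerivAt_id (0 : ℝ)).const_add _
    have h2 : HasDerivAt (fun t : ℝ => ⟪y, x⟫_ℝ + t * ⟪y, h⟫_ℝ) ⟪y, h⟫_ℝ 0 := by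
      simpa using ((hasDerivAt_id (0 : ℝ)).mul_const ⟪y, h⟫_ℝ).const_add ⟪y, x⟫_ℝ
    have h3 : HasDerivAt (fun t : ℝ => (1 + (⟪h, x⟫_ℝ + t) ^ 2)⁻¹)
        (-(2 * ⟪h, x⟫_ℝ) / (1 + ⟪h, x⟫_ℝ ^ 2) ^ 2) 0 := by
      refine (((h1.pow 2).const_add 1).inv (by simpa using (hpos _).ne')).congr_deriv ?_
      simp
    have h4 : HasDerivAt (fun t : ℝ => τ (⟪y, x⟫_ℝ + t * ⟪y, h⟫_ℝ))
        (τ' ⟪y, x⟫_ℝ * ⟪y, h⟫_ℝ) 0 :=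
      HasDerivAt.comp (0 : ℝ) (by simpa using hτ ⟪y, x⟫_ℝ) h2
    have h5 := h3.mul h4
    simp only [add_zero, zero_mul] at h5
    refine h5.congr_of_eventuallyEq (Eventually.of_forall fun t => ?_)
    simp only [Pi.mul_apply, inner_add_right, real_inner_smul_right, real_inner_self_eq_norm_sq,
      hh]
    ring_nf
  · rw [abs_mul]
    have := mul_le_mul (b1 ⟪h, x⟫_ℝ) (hb ⟪y, x⟫_ℝ) (abs_nonneg _) zero_le_one
    linarith [abs_nonneg ⟪y, h⟫_ℝ]
  · refine (abs_add_le _ _).trans (add_le_add ?_ ?_)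
    · rw [abs_mul]
      have := mul_le_mul (b3 ⟪h, x⟫_ℝ) (hb ⟪y, x⟫_ℝ) (abs_nonneg _) zero_le_two
      linarith
    · rw [abs_mul, abs_mul]
      have h1 := mul_le_mul_of_nonneg_right (hb' ⟪y, x⟫_ℝ) (abs_nonneg ⟪y, h⟫_ℝ)
      have h2 := mul_le_mul (b1 ⟪h, x⟫_ℝ) h1 (by positivity) zero_le_one
      linarith
  · rw [← mul_assoc, abs_mul]
    have := mul_le_mul (b2 ⟪h, x⟫_ℝ) (hb ⟪y, x⟫_ℝ) (abs_nonneg _) zero_le_one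
    linarith [abs_nonneg ⟪y, h⟫_ℝ]

variable [CompleteSpace X] [SecondCountableTopology X] [MeasurableSpace X] [BorelSpace X]
  {μ : Measure X} [IsGaussian μ] {ι : Type*} {e : HilbertBasis ι ℝ X} {lam : ι → ℝ}

/-- Integration by parts applied to the product `φ ψ`, with the term containing `ψ'` moved to the
right: no derivative of `φ` remains there. -/
theorem IsCylindricalC1b.integral_gradient_mul (hmean : ∫ x, x ∂μ = 0) {h : X} {l : ℝ}
    (hl : 0 < l) (hh : ‖h‖ = 1) (hQ : covarianceOperator μ h = l • h) {ψ ψ' : X → ℝ}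
    (hψ : IsTestFunction h ψ ψ') {φ : X → ℝ} (hφ : IsCylindricalC1b e φ) :
    l * ∫ x, ⟪h, gradient φ x⟫_ℝ * ψ x ∂μ = ∫ x, φ x * (⟪h, x⟫_ℝ * ψ x - l * ψ' x) ∂μ := by
  obtain ⟨C, hC⟩ := hφ.exists_bound
  obtain ⟨D, hD⟩ := hψ.bounded
  have hC0 : 0 ≤ C := (abs_nonneg _).trans (hC 0).1
  have hφc := hφ.contDiff.continuous
  have hgc : Continuous fun x => ⟪h, gradient φ x⟫_ℝ :=
    continuous_const.inner (continuous_gradient hφ.contDiff)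
  have hgb : ∀ x, |⟪h, gradient φ x⟫_ℝ| ≤ C := fun x => by
    refine (abs_real_inner_le_norm _ _).trans ?_
    rw [hh, one_mul]
    exact (hC x).2
  have hb1 : ∀ x, |⟪h, gradient φ x⟫_ℝ * ψ x| ≤ C * D := fun x => by
    rw [abs_mul]
    exact mul_le_mul (hgb x) (hD x).1 (abs_nonneg _) hC0
  have hb2 : ∀ x, |φ x * ψ' x| ≤ C * D := fun x => by
    rw [abs_mul]
    exact mul_le_mul (hC x).1 (hD x).2.1 (abs_nonneg _) hC0
  have hb3 : ∀ x, |φ x * ψ x| ≤ C * D := fun x => by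
    rw [abs_mul]
    exact mul_le_mul (hC x).1 (hD x).1 (abs_nonneg _) hC0
  have hb4 : ∀ x, |φ x * (⟪h, x⟫_ℝ * ψ x)| ≤ C * D := fun x => by
    rw [abs_mul]
    exact mul_le_mul (hC x).1 (hD x).2.2 (abs_nonneg _) hC0
  have hCD : 0 ≤ C * D := (abs_nonneg _).trans (hb1 0)
  have hibp := integral_directional_deriv hmean hl hh hQ (F := fun x => φ x * ψ x)
    (F' := fun x => ⟪h, gradient φ x⟫_ℝ * ψ x + φ x * ψ' x) (hφc.mul hψ.continuous)
    ((hgc.mul hψ.continuous).add (hφc.mul hψ.continuous_deriv)) (C := C * D + C * D)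
    (fun x => by
      have h1 : HasDerivAt (fun t : ℝ => φ (x + t • h)) ⟪h, gradient φ x⟫_ℝ 0 := by
        have h2 : HasDerivAt (fun t : ℝ => x + t • h) h 0 := by
          simpa using ((hasDerivAt_id (0 : ℝ)).smul_const h).const_add x
        rw [real_inner_comm, inner_gradient hφ.contDiff]
        refine HasFDerivAt.comp_hasDerivAt (0 : ℝ) ?_ h2
        simpa using (hφ.contDiff.differentiable one_ne_zero x).hasFDerivAt
      refine (h1.mul (hψ.hasDerivAt x)).congr_deriv ?_
      simp)
    (fun x => (hb3 x).trans (by linarith))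
    (fun x => (abs_add_le _ _).trans (add_le_add (hb1 x) (hb2 x)))
  have i1 : Integrable (fun x => ⟪h, gradient φ x⟫_ℝ * ψ x) μ :=
    Integrable.of_bound (hgc.mul hψ.continuous).aestronglyMeasurable _ (Eventually.of_forall hb1)
  have i2 : Integrable (fun x => φ x * ψ' x) μ :=
    Integrable.of_bound (hφc.mul hψ.continuous_deriv).aestronglyMeasurable _
      (Eventually.of_forall hb2)
  have i3 : Integrable (fun x => φ x * (⟪h, x⟫_ℝ * ψ x)) μ :=
    Integrable.of_bound (hφc.mul ((by fun_prop : Continuous fun x : X => ⟪h, x⟫_ℝ).mul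
      hψ.continuous)).aestronglyMeasurable _ (Eventually.of_forall hb4)
  rw [integral_add i1 i2, mul_add] at hibp
  have e1 : ∀ x, φ x * (⟪h, x⟫_ℝ * ψ x - l * ψ' x)
      = φ x * (⟪h, x⟫_ℝ * ψ x) - l * (φ x * ψ' x) := fun x => by ring
  have e2 : ∫ x, ⟪h, x⟫_ℝ * (φ x * ψ x) ∂μ = ∫ x, φ x * (⟪h, x⟫_ℝ * ψ x) ∂μ :=
    integral_congr_ae (Eventually.of_forall fun x => by simp only; ring)
  simp only [e1]
  rw [integral_sub i3 (i2.const_mul l), integral_const_mul]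
  linarith

/-- The cylindrical identity survives `L^p` limits because both multipliers, `ψ` and `⟪e k, x⟫ ψ -
lam k ψ'`, are bounded. The right side depends only on `u`, which is what uniqueness needs. -/
theorem HasSobolevGradient.integral_mul (hmean : ∫ x, x ∂μ = 0) (hlam : ∀ k, 0 < lam k) {B : ℝ}
    (hB : ∀ k, lam k ≤ B) (hQ : ∀ k, covarianceOperator μ (e k) = lam k • e k) {θ : ℝ}
    (hθ : 0 ≤ θ) {p : ℝ≥0∞} (hp : 1 ≤ p) {u : X → ℝ} {G : X → X}
    (hG : HasSobolevGradient μ e lam θ p u G) (k : ι) {ψ ψ' : X → ℝ}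
    (hψ : IsTestFunction (e k) ψ ψ') :
    lam k * ∫ x, ⟪e k, G x⟫_ℝ * ψ x ∂μ
      = lam k ^ θ * ∫ x, u x * (⟪e k, x⟫_ℝ * ψ x - lam k * ψ' x) ∂μ := by
  obtain ⟨T, hT, hTe⟩ := exists_powQ_clm e hlam hB hθ
  obtain ⟨hu, hGm, φ, hφ, h1, h2⟩ := hG
  obtain ⟨D, hD⟩ := hψ.bounded
  have hek : ‖e k‖ = 1 := e.orthonormal.1 k
  have hψ2 : ∀ x, |⟪e k, x⟫_ℝ * ψ x - lam k * ψ' x| ≤ D + lam k * D := fun x => by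
    refine (abs_sub _ _).trans (add_le_add (hD x).2.2 ?_)
    rw [abs_mul, abs_of_pos (hlam k)]
    exact mul_le_mul_of_nonneg_left (hD x).2.1 (hlam k).le
  have hinner : Continuous fun x : X => ⟪e k, x⟫_ℝ := by fun_prop
  have l1 := (tendsto_integral_mul_of_eLpNorm hp (g := u)
    (b := fun x => ⟪e k, x⟫_ℝ * ψ x - lam k * ψ' x) (fun n => by
      obtain ⟨C, hC⟩ := (hφ n).exists_bound
      exact Integrable.of_bound (hφ n).aestronglyMeasurable C
        (Eventually.of_forall fun x => (hC x).1)) (hu.integrable hp) h1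
    ((hinner.mul hψ.continuous).sub
      (continuous_const.mul hψ.continuous_deriv)).aestronglyMeasurable hψ2).const_mul (lam k ^ θ)
  have hcomp : ∀ n, AEStronglyMeasurable (fun x => ⟪e k, powQ e lam θ (gradient (φ n) x)⟫_ℝ) μ :=
    fun n => hinner.comp_aestronglyMeasurable ((hφ n).aestronglyMeasurable_powQ hlam hB hθ)
  have l2 := (tendsto_integral_mul_of_eLpNorm hp
    (f := fun n x => ⟪e k, powQ e lam θ (gradient (φ n) x)⟫_ℝ)
    (g := fun x => ⟪e k, G x⟫_ℝ) (b := ψ) (fun n => by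
      obtain ⟨C, hC⟩ := (hφ n).exists_bound
      refine Integrable.of_bound (hcomp n) (lam k ^ θ * C) (Eventually.of_forall fun x => ?_)
      rw [hTe, norm_mul, Real.norm_of_nonneg (Real.rpow_nonneg (hlam k).le _)]
      refine mul_le_mul_of_nonneg_left ?_ (Real.rpow_nonneg (hlam k).le _)
      refine (norm_inner_le_norm _ _).trans ?_
      rw [hek, one_mul]
      exact (hC x).2)
    ((hGm.integrable hp).const_inner (e k))
    (tendsto_of_tendsto_of_tendsto_of_le_of_le tendsto_const_nhds h2 (fun _ => zero_le)
      fun n => eLpNorm_mono fun x => by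
        rw [← inner_sub_right]
        refine (norm_inner_le_norm _ _).trans ?_
        rw [hek, one_mul])
    hψ.continuous.aestronglyMeasurable fun x => (hD x).1).const_mul (lam k)
  refine tendsto_nhds_unique l2 (l1.congr fun n => ?_)
  rw [← (hφ n).integral_gradient_mul hmean (hlam k) hek (hQ k) hψ]
  simp only [hTe, mul_assoc]
  rw [integral_const_mul]
  ring

/-- Closability of `Q^θ D`: the Sobolev gradient is unique. -/
theorem HasSobolevGradient.unique [Countable ι] (hmean : ∫ x, x ∂μ = 0) (hlam : ∀ k, 0 < lam k)
    {B : ℝ} (hB : ∀ k, lam k ≤ B) (hQ : ∀ k, covarianceOperator μ (e k) = lam k • e k) {θ : ℝ}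
    (hθ : 0 ≤ θ) {p : ℝ≥0∞} (hp : 1 ≤ p) {u : X → ℝ} {G H : X → X}
    (hG : HasSobolevGradient μ e lam θ p u G) (hH : HasSobolevGradient μ e lam θ p u H) :
    G =ᵐ[μ] H := by
  have hcoord : ∀ k, ∀ᵐ x ∂μ, ⟪e k, G x⟫_ℝ = ⟪e k, H x⟫_ℝ := by
    intro k
    have iG : Integrable (fun x => ⟪e k, G x⟫_ℝ) μ := (hG.2.1.integrable hp).const_inner (e k)
    have iH : Integrable (fun x => ⟪e k, H x⟫_ℝ) μ := (hH.2.1.integrable hp).const_inner (e k)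
    have hpos : ∀ s : ℝ, 0 < 1 + s ^ 2 := fun s => by positivity
    have hχc : Continuous fun x : X => (1 + ⟪e k, x⟫_ℝ ^ 2)⁻¹ :=
      (by fun_prop : Continuous fun x : X => 1 + ⟪e k, x⟫_ℝ ^ 2).inv₀ fun x => (hpos _).ne'
    have hχb : ∀ x : X, ‖(1 + ⟪e k, x⟫_ℝ ^ 2)⁻¹‖ ≤ 1 := fun x => by
      rw [Real.norm_of_nonneg (inv_pos.2 (hpos _)).le]
      exact inv_le_one_of_one_le₀ (by nlinarith [sq_nonneg ⟪e k, x⟫_ℝ])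
    have hzero : ∀ {τ τ' : ℝ → ℝ} (y : X), (∀ t, HasDerivAt τ (τ' t) t) → Continuous τ' →
        (∀ t, |τ t| ≤ 1) → (∀ t, |τ' t| ≤ 1) →
        ∫ x, (⟪e k, G x⟫_ℝ - ⟪e k, H x⟫_ℝ) * (1 + ⟪e k, x⟫_ℝ ^ 2)⁻¹ * τ ⟪y, x⟫_ℝ ∂μ = 0 := by
      intro τ τ' y h1 h2 h3 h4
      have hψ := isTestFunction_trig (e.orthonormal.1 k) y h1 h2 h3 h4
      obtain ⟨D, hD⟩ := hψ.bounded
      have e1 := hG.integral_mul hmean hlam hB hQ hθ hp k hψ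
      rw [← hH.integral_mul hmean hlam hB hQ hθ hp k hψ] at e1
      have e2 := mul_left_cancel₀ (hlam k).ne' e1
      have hm := hψ.continuous.aestronglyMeasurable (μ := μ)
      have hD' := Eventually.of_forall (f := ae μ) fun x => (hD x).1
      rw [← sub_eq_zero, ← integral_sub (iG.mul_bdd hm hD') (iH.mul_bdd hm hD')] at e2
      rw [← e2]
      exact integral_congr_ae (Eventually.of_forall fun x => by simp only; ring)
    -- Fourier uniqueness is applied to the weighted coordinate difference; the weight never
    -- vanishes.
    have h := ae_eq_zero_of_integral_cos_sin
      ((iG.sub iH).mul_bdd hχc.aestronglyMeasurable (Eventually.of_forall hχb))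
      (fun y => hzero y (τ' := fun t => -Real.sin t) Real.hasDerivAt_cos (by fun_prop)
        Real.abs_cos_le_one fun t => by rw [abs_neg]; exact Real.abs_sin_le_one t)
      (fun y => hzero y Real.hasDerivAt_sin Real.continuous_cos Real.abs_sin_le_one
        Real.abs_cos_le_one)
    filter_upwards [h] with x hx
    rcases mul_eq_zero.1 hx with h0 | h0
    · exact sub_eq_zero.1 h0
    · exact absurd h0 (inv_pos.2 (hpos _)).ne'
  filter_upwards [ae_all_iff.2 hcoord] with x hx
  refine e.repr.injective (lp.ext (funext fun k => ?_))
  rw [e.repr_apply_apply, e.repr_apply_apply, hx k]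

theorem HasSobolevGradient.sobolevGradient_ae_eq [Countable ι] (hmean : ∫ x, x ∂μ = 0)
    (hlam : ∀ k, 0 < lam k) {B : ℝ} (hB : ∀ k, lam k ≤ B)
    (hQ : ∀ k, covarianceOperator μ (e k) = lam k • e k) {θ : ℝ}
    (hθ : 0 ≤ θ) {p : ℝ≥0∞} (hp : 1 ≤ p) {u : X → ℝ} {G : X → X}
    (hG : HasSobolevGradient μ e lam θ p u G) :
    sobolevGradient μ e lam θ p u =ᵐ[μ] G := by
  have hmem : MemSobolev μ e lam θ p u := ⟨G, hG⟩
  rw [sobolevGradient, dif_pos hmem]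
  exact HasSobolevGradient.unique hmean hlam hB hQ hθ hp hmem.choose_spec hG

end Uniqueness

/-! ### Sobolev regularity of `U_α` and passage to the limit -/

section MoreauYosida

variable {X : Type*} [NormedAddCommGroup X] [InnerProductSpace ℝ X] [CompleteSpace X]
  {U : X → EReal}

/-- Testing the infimum at a fixed `x₀` bounds `U_α` above by a quadratic, the lower bound of `U`
bounds it below, and the Lipschitz `g_α` grows linearly. -/
theorem IsProperConvex.exists_growth_bound (hU : IsProperConvex U) {α : ℝ} (hα : 0 < α) :
    ∃ K : ℝ, (∀ x, |(moreauYosida U α x).toReal| ≤ K * (1 + ‖x‖) ^ 2) ∧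
      ∀ x, ‖yosida U α x‖ ≤ K * (1 + ‖x‖) := by
  obtain ⟨C, hC⟩ := hU.bddBelow
  obtain ⟨x₀, hx₀⟩ := hU.proper
  set r := (U x₀).toReal
  set A := (1 + ‖x₀‖) ^ 2 / (2 * α) with hA
  have hA0 : 0 ≤ A := by positivity
  have hB0 : 0 ≤ ‖yosida U α 0‖ + α⁻¹ := by positivity
  refine ⟨|C| + |r| + A + (‖yosida U α 0‖ + α⁻¹), fun x => ?_, fun x => ?_⟩
  · have h1 := le_toReal_moreauYosida hU hC hα x
    have h2 := moreauYosida_le U α x x₀ (hU.coe_toReal hx₀)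
    rw [hU.moreauYosida_coe_toReal hα, EReal.coe_le_coe_iff] at h2
    have h3 : ‖x - x₀‖ ^ 2 / (2 * α) ≤ A * (1 + ‖x‖) ^ 2 := by
      rw [hA, div_mul_eq_mul_div, ← mul_pow]
      gcongr
      nlinarith [norm_sub_le x x₀, norm_nonneg x, norm_nonneg x₀,
        mul_nonneg (norm_nonneg x) (norm_nonneg x₀)]
    have h4 : 1 ≤ (1 + ‖x‖) ^ 2 := one_le_pow₀ (by linarith [norm_nonneg x])
    have h5 : |C| ≤ |C| * (1 + ‖x‖) ^ 2 := le_mul_of_one_le_right (abs_nonneg _) h4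
    have h6 : |r| ≤ |r| * (1 + ‖x‖) ^ 2 := le_mul_of_one_le_right (abs_nonneg _) h4
    have h7 : 0 ≤ A * (1 + ‖x‖) ^ 2 := by positivity
    have h8 : 0 ≤ (‖yosida U α 0‖ + α⁻¹) * (1 + ‖x‖) ^ 2 := by positivity
    rw [add_mul, add_mul, add_mul, abs_le]
    constructor
    · linarith [neg_abs_le C, abs_nonneg r]
    · linarith [le_abs_self r, abs_nonneg C]
  · have h1 := hU.norm_yosida_sub_le hα 0 x
    have h2 := norm_le_insert' (yosida U α x) (yosida U α 0)
    rw [sub_zero] at h1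
    have h3 : 0 ≤ (|C| + |r| + A) * (1 + ‖x‖) := by positivity
    have h4 : 0 ≤ ‖yosida U α 0‖ * ‖x‖ := by positivity
    have h5 : 0 ≤ α⁻¹ := by positivity
    nlinarith

variable [SecondCountableTopology X] [MeasurableSpace X] [BorelSpace X]
  {μ : Measure X} [IsGaussian μ] {ι : Type*} [Countable ι] {e : HilbertBasis ι ℝ X} {lam : ι → ℝ}

theorem IsProperConvex.hasSobolevGradient_moreauYosida (hU : IsProperConvex U) {α : ℝ}
    (hα : 0 < α) {p : ℝ≥0∞} (hp1 : 1 ≤ p) (hp : p ≠ ∞) :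
    HasSobolevGradient μ e lam 0 p (fun x => (moreauYosida U α x).toReal) (yosida U α) := by
  obtain ⟨K, h1, h2⟩ := hU.exists_growth_bound hα
  exact hasSobolevGradient_of_hasGradientAt e lam μ hp1 hp (hU.hasGradientAt_moreauYosida hα)
    (hU.continuous_yosida hα) h1 h2


theorem tendsto_one_div_add_nhdsGT :
    Tendsto (fun n : ℕ => 1 / ((n : ℝ) + 1)) atTop (𝓝[>] 0) :=
  tendsto_nhdsWithin_iff.2 ⟨tendsto_one_div_add_atTop_nhds_zero_nat,
    Eventually.of_forall fun n => by simp only [Set.mem_Ioi]; positivity⟩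

/-- `D₀U` is an a.e. limit of the continuous maps `g_α` along `α = 1 / (n + 1)`. -/
theorem IsProperConvex.aestronglyMeasurable_minNormSubgradient (hU : IsProperConvex U)
    (hne : ∀ᵐ x ∂μ, (subdifferential U x).Nonempty) :
    AEStronglyMeasurable (minNormSubgradient U) μ := by
  refine aestronglyMeasurable_of_tendsto_ae atTop
    (f := fun (n : ℕ) x => yosida U (1 / ((n : ℝ) + 1)) x)
    (fun n => (hU.continuous_yosida (by positivity)).aestronglyMeasurable) ?_
  filter_upwards [hne] with x hx
  exact (hU.tendsto_yosida hx).comp tendsto_one_div_add_nhdsGT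

theorem exists_holderTriple {p₀ p₁ : ℝ≥0∞} (h : p₀ < p₁) :
    ∃ q : ℝ≥0∞, q ≠ ∞ ∧ ENNReal.HolderTriple p₁ q p₀ := by
  have hinv : p₁⁻¹ < p₀⁻¹ := ENNReal.inv_lt_inv.2 h
  refine ⟨(p₀⁻¹ - p₁⁻¹)⁻¹, ?_, ⟨?_⟩⟩
  · rw [Ne, ENNReal.inv_eq_top]
    exact (tsub_pos_of_lt hinv).ne'
  · rw [inv_inv, add_tsub_cancel_of_le hinv.le]

/-- The subgradient inequality at `x`, tested at a fixed `x₀`, gives `C ≤ U x ≤ U x₀ + ‖D₀U x‖ ‖x -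
x₀‖`. Strictness of `p₀ < p₁` makes the Hölder partner `q` finite, so `‖x - x₀‖` is in `L^q` for a
Gaussian. -/
theorem IsProperConvex.memLp_toReal (hU : IsProperConvex U)
    (hne : ∀ᵐ x ∂μ, (subdifferential U x).Nonempty) {p₀ p₁ : ℝ≥0∞} (h : p₀ < p₁)
    (hLp : MemLp (fun x => ‖minNormSubgradient U x‖) p₁ μ) :
    MemLp (fun x => (U x).toReal) p₀ μ := by
  obtain ⟨C, hC⟩ := hU.bddBelow
  obtain ⟨x₀, hx₀⟩ := hU.proper
  obtain ⟨q, hq, hpq⟩ := exists_holderTriple h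
  have hid : MemLp (fun x : X => x) q μ := IsGaussian.memLp_id μ q hq
  have hconst : MemLp (fun _ : X => x₀) q μ := memLp_const x₀
  have hdist : MemLp (fun x => ‖x - x₀‖) q μ := (hid.sub hconst).norm
  have hprod : MemLp (fun x => ‖minNormSubgradient U x‖ * ‖x - x₀‖) p₀ μ := hdist.mul' hLp
  have hconst' : MemLp (fun _ : X => |C| + |(U x₀).toReal|) p₀ μ := memLp_const _
  have hb : MemLp (fun x => |C| + |(U x₀).toReal|
      + ‖minNormSubgradient U x‖ * ‖x - x₀‖) p₀ μ := hconst'.add hprod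
  refine hb.mono' hU.lsc.measurable.ereal_toReal.aestronglyMeasurable ?_
  filter_upwards [hne] with x hx
  have hz := (minNormSubgradient_spec U x (hU.ne_bot x) hx).1
  have h1 := mem_subdifferential_real (hU.coe_toReal hz.1) hz (hU.coe_toReal hx₀)
  have h2 := real_inner_le_norm (minNormSubgradient U x) (x - x₀)
  rw [← neg_sub x x₀, inner_neg_right] at h1
  have h3 := hC x
  rw [hU.coe_toReal hz.1, EReal.coe_le_coe_iff] at h3
  have h4 : 0 ≤ ‖minNormSubgradient U x‖ * ‖x - x₀‖ := by positivity
  rw [Real.norm_eq_abs, abs_le]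
  constructor
  · linarith [neg_abs_le C, abs_nonneg (U x₀).toReal]
  · linarith [le_abs_self (U x₀).toReal, abs_nonneg C]

/-- From `C ≤ U_α ≤ U`, the function `U - C` dominates `|U_α - U|`. -/
theorem IsProperConvex.tendsto_eLpNorm_moreauYosida (hU : IsProperConvex U)
    (hne : ∀ᵐ x ∂μ, (subdifferential U x).Nonempty) {p : ℝ≥0∞} (hp0 : p ≠ 0) (hp : p ≠ ∞)
    (hmem : MemLp (fun x => (U x).toReal) p μ) :
    Tendsto (fun α => eLpNorm (fun x => (moreauYosida U α x).toReal - (U x).toReal) p μ)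
      (𝓝[>] 0) (𝓝 0) := by
  obtain ⟨C, hC⟩ := hU.bddBelow
  refine tendsto_eLpNorm_of_dominated hp0 hp (b := fun x => (U x).toReal - C) ?_ hmem.1
    (hmem.sub (memLp_const C)) ?_ ?_
  · filter_upwards [self_mem_nhdsWithin] with α hα
    exact (contDiff_of_hasGradientAt (hU.hasGradientAt_moreauYosida hα)
      (hU.continuous_yosida hα)).continuous.aestronglyMeasurable
  · filter_upwards [self_mem_nhdsWithin] with α hα
    filter_upwards [hne] with x hx
    have h1 := hU.toReal_moreauYosida_le hα hx.some_mem.1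
    have h2 := le_toReal_moreauYosida hU hC hα x
    rw [Real.norm_eq_abs, abs_le]
    constructor <;> linarith
  · filter_upwards [hne] with x hx using hU.tendsto_moreauYosida hx

theorem IsProperConvex.tendsto_eLpNorm_yosida (hU : IsProperConvex U)
    (hne : ∀ᵐ x ∂μ, (subdifferential U x).Nonempty) {p : ℝ≥0∞} (hp0 : p ≠ 0) (hp : p ≠ ∞)
    (hmem : MemLp (minNormSubgradient U) p μ) :
    Tendsto (fun α => eLpNorm (fun x => yosida U α x - minNormSubgradient U x) p μ)
      (𝓝[>] 0) (𝓝 0) := by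
  refine tendsto_eLpNorm_of_dominated hp0 hp (b := fun x => 2 * ‖minNormSubgradient U x‖) ?_
    hmem.1 (hmem.norm.const_mul 2) ?_ ?_
  · filter_upwards [self_mem_nhdsWithin] with α hα
      using (hU.continuous_yosida hα).aestronglyMeasurable
  · filter_upwards [self_mem_nhdsWithin] with α hα
    filter_upwards [hne] with x hx
    have h1 := hU.norm_yosida_le hα (minNormSubgradient_spec U x (hU.ne_bot x) hx).1
    linarith [norm_sub_le (yosida U α x) (minNormSubgradient U x)]
  · filter_upwards [hne] with x hx using hU.tendsto_yosida hx

theorem IsProperConvex.hasSobolevGradient (hU : IsProperConvex U)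
    (hlam : ∀ k, 0 < lam k) {B : ℝ} (hB : ∀ k, lam k ≤ B)
    (hne : ∀ᵐ x ∂μ, (subdifferential U x).Nonempty) {p : ℝ≥0∞} (hp1 : 1 ≤ p) (hp : p ≠ ∞)
    (hmem : MemLp (fun x => (U x).toReal) p μ) (hmem' : MemLp (minNormSubgradient U) p μ) :
    HasSobolevGradient μ e lam 0 p (fun x => (U x).toReal) (minNormSubgradient U) := by
  have hp0 : p ≠ 0 := (zero_lt_one.trans_le hp1).ne'
  exact HasSobolevGradient.of_tendsto hlam hB le_rfl hp1
    (fun n : ℕ => hU.hasSobolevGradient_moreauYosida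
      (show (0 : ℝ) < 1 / ((n : ℝ) + 1) by positivity) hp1 hp) hmem hmem'
    ((hU.tendsto_eLpNorm_moreauYosida hne hp0 hp hmem).comp tendsto_one_div_add_nhdsGT)
    ((hU.tendsto_eLpNorm_yosida hne hp0 hp hmem').comp tendsto_one_div_add_nhdsGT)

end MoreauYosida

end GaussSobolev

/-! ### The main statement -/

theorem lemma2p2 {X : Type*} [NormedAddCommGroup X] [InnerProductSpace ℝ X] [CompleteSpace X]
    [SecondCountableTopology X] [MeasurableSpace X] [BorelSpace X]
    {ι : Type*} [Countable ι] (e : HilbertBasis ι ℝ X)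
    (Q : X →L[ℝ] X) (lam : ι → ℝ) (hlam : ∀ k, 0 < lam k) (hQ : ∀ k, Q (e k) = lam k • e k)
    (μ : Measure X) [IsGaussian μ] (hmean : ∫ x, x ∂μ = 0) (hcov : covarianceOperator μ = Q)
    (U : X → EReal) (hconv : IsConvex U) (hlsc : LowerSemicontinuous U)
    (hbdd : ∃ C : ℝ, ∀ x, (C : EReal) ≤ U x)
    (p₁ : ℝ≥0∞) (hp₁ : 1 < p₁)
    (hne : ∀ᵐ x ∂μ, (subdifferential U x).Nonempty)
    (hLp : MemLp (fun x => ‖minNormSubgradient U x‖) p₁ μ) :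
    ∀ p₀ : ℝ≥0∞, 1 ≤ p₀ → p₀ < p₁ →
      (∀ᵐ x ∂μ, U x ≠ ⊤) ∧
      MemSobolev μ e lam 0 p₀ (fun x => (U x).toReal) ∧
      sobolevGradient μ e lam 0 p₀ (fun x => (U x).toReal) =ᵐ[μ] minNormSubgradient U ∧
      ∀ θ : ℝ, 0 ≤ θ →
        MemSobolev μ e lam θ p₀ (fun x => (U x).toReal) ∧
        (∀ α : ℝ, 0 < α → MemSobolev μ e lam θ p₀ (fun x => (moreauYosida U α x).toReal)) ∧
        Tendsto (fun α : ℝ => sobolevNorm μ e lam θ p₀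
            (fun x => (moreauYosida U α x).toReal - (U x).toReal))
          (𝓝[>] 0) (𝓝 0) := by
  intro p₀ hp1 hlt
  have hp : p₀ ≠ ∞ := hlt.ne_top
  have hp0 : p₀ ≠ 0 := (zero_lt_one.trans_le hp1).ne'
  have hfin : ∀ᵐ x ∂μ, U x ≠ ⊤ := hne.mono fun x hx => hx.some_mem.1
  have hU : IsProperConvex U := ⟨hconv, hlsc, hbdd, hfin.exists⟩
  have hQ' : ∀ k, covarianceOperator μ (e k) = lam k • e k := fun k => by rw [hcov, hQ]
  have hB : ∀ k, lam k ≤ ‖Q‖ := fun k => by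
    have h := Q.le_opNorm (e k)
    rwa [hQ, norm_smul, e.orthonormal.1, mul_one, mul_one, Real.norm_of_nonneg (hlam k).le] at h
  have hmem := hU.memLp_toReal hne hlt hLp
  have hmem' : MemLp (minNormSubgradient U) p₀ μ :=
    (memLp_norm_iff (hU.aestronglyMeasurable_minNormSubgradient hne)).1
      (hLp.mono_exponent hlt.le)
  have hS := hU.hasSobolevGradient (e := e) hlam hB hne hp1 hp hmem hmem'
  refine ⟨hfin, ⟨_, hS⟩, hS.sobolevGradient_ae_eq hmean hlam hB hQ' le_rfl hp1,
    fun θ hθ => ⟨⟨_, hS.powQ_of_zero hlam hB hθ⟩, fun α hα =>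
      ⟨_, (hU.hasSobolevGradient_moreauYosida hα hp1 hp).powQ_of_zero hlam hB hθ⟩, ?_⟩⟩
  obtain ⟨T, hT, -⟩ := exists_powQ_clm e hlam hB hθ
  have hgrad : Tendsto (fun α => eLpNorm (sobolevGradient μ e lam θ p₀
      (fun x => (moreauYosida U α x).toReal - (U x).toReal)) p₀ μ) (𝓝[>] 0) (𝓝 0) := by
    have hlim : Tendsto (fun α => ‖T‖₊ • eLpNorm (fun x => yosida U α x - minNormSubgradient U x)
        p₀ μ) (𝓝[>] 0) (𝓝 0) := by
      have := ENNReal.Tendsto.const_mul (a := (‖T‖₊ : ℝ≥0∞))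
        (hU.tendsto_eLpNorm_yosida hne hp0 hp hmem') (Or.inr ENNReal.coe_ne_top)
      simpa [ENNReal.smul_def] using this
    refine tendsto_of_tendsto_of_tendsto_of_le_of_le' tendsto_const_nhds hlim
      (Eventually.of_forall fun _ => zero_le) ?_
    filter_upwards [self_mem_nhdsWithin] with α hα
    -- Membership of `U_α - U` must be exhibited: otherwise `sobolevGradient` could be its default
    -- `0`. Uniqueness then identifies the chosen gradient a.e. with `Q^θ (g_α - D₀U)`.
    have hsub := ((hU.hasSobolevGradient_moreauYosida (e := e) (lam := lam) (μ := μ) hα hp1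
      hp).powQ_of_zero hlam hB hθ).sub hlam hB hθ hp1 (hS.powQ_of_zero hlam hB hθ)
    rw [eLpNorm_congr_ae (hsub.sobolevGradient_ae_eq hmean hlam hB hQ' hθ hp1)]
    simp only [hT, ← map_sub]
    exact eLpNorm_le_nnreal_smul_eLpNorm_of_ae_le_mul
      (Eventually.of_forall fun x => T.le_opNNNorm _) p₀
  have hpos : 0 < p₀.toReal := ENNReal.toReal_pos hp0 hp
  have h := (((hU.tendsto_eLpNorm_moreauYosida hne hp0 hp hmem).ennrpow_const p₀.toReal).add
    (hgrad.ennrpow_const p₀.toReal)).ennrpow_const (1 / p₀.toReal)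
  rwa [ENNReal.zero_rpow_of_pos hpos, add_zero, ENNReal.zero_rpow_of_pos (by positivity)] at h
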